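/- Let $n\ge 10$ and work over $\mathbb C$. Let $\mathcal T_n$ be the rank $3$ matroid with ground set $\mathbb Z/n\mathbb Z$ whose non-bases are the three-element subsets $\{i,j,k\}$ with $i+j+k=0$. A realization of $\mathcal T_n$ is a family $(p_k)_{k\in\mathbb Z/n\mathbb Z}$ of distinct points of $\mathbb P^2(\mathbb C)$ such that, for distinct $i,j,k$, the points $p_i,p_j,p_k$ are collinear if and only if $i+j+k=0$. Let $\mathcal R(\mathcal T_n)$ be the set of realizations modulo $\mathrm{PGL}_3(\mathbb C)$. Let $X_1(n)^\circ$ be the set of isomorphism classes of pairs $(E,t)$ of a complex elliptic curve $E$ and a point $t\in E$ of exact order $n$ (the complement of the cusps in the modular curve $X_1(n)$), and let $\phi_n$ send $(E,t)$ to the class of $(kt)_{k\in\mathbb Z/n\mathbb Z}$, where $E$ is embedded in $\mathbb P^2$ as a plane cubic so that its neutral element is a flex (a Weierstrass embedding). For an integer $a$ with $\gcd(a,n)=1$ and $\zeta=e^{2\pi i/n}$, consider the points $p_1=(0:1:0)$, $p_2=(0:0:1)$, $p_{-3}=(0:1:1)$ and, for $k\not\equiv -3,1,2 \pmod n$, $$p_k=\left(1:\frac{(1-\zeta^{2a})(1+\zeta^{3a})(1-\zeta^{ak})(1-\zeta^{a(k+2)})}{(1-\zeta^{5a})(1-\zeta^{a(k-1)})(1-\zeta^{a(k+3)})}:\frac{(1-\zeta^{a}+\zeta^{2a})(1-\zeta^{ak})(1-\zeta^{a(k+1)})}{(1+\zeta^{2a})(1-\zeta^{a(k-2)})(1-\zeta^{a(k+3)})}\right).$$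 Let $N_n$ be the finite set of classes of these configurations. Then, as sets of classes of labeled point configurations modulo $\mathrm{PGL}_3(\mathbb C)$, $$\mathcal R(\mathcal T_n)=\phi_n(X_1(n)^\circ)\cup N_n .$$ Moreover, for every realization $p=(p_k)$ of $\mathcal T_n$ there is a plane cubic through all the points $p_k$, unique up to scaling its equation; this cubic is either smooth or nodal; $p_0$ is a flex of it, and the $p_k$ are smooth points of it that form, for the group law on its smooth points with neutral element $p_0$, a cyclic subgroup of order $n$ with $p_k=k\,p_1$. The cubic is smooth if and only if $[p]\in\phi_n(X_1(n)^\circ)$, and nodal if and only if $[p]\in N_n$. -/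

import Mathlib

open scoped MatrixGroups LinearAlgebra.Projectivization

noncomputable section

namespace TorsionArrangement

/-! ### Labeled point arrangements and realizations of rank 3 matroids -/

/-- The complex projective plane. -/
abbrev Plane : Type := ℙ ℂ (Fin 3 → ℂ)

/-- Labeled point arrangements up to projective transformations: orbits of the group
`PGL(3, ℂ)` acting diagonally on families of points of the plane. -/
abbrev ArrangementClass (α : Type) : Type :=
  MulAction.orbitRel.Quotient PGL(3, ℂ) (α → Plane)

/-- The class `[p]` of a labeled point arrangement. -/
def arrangementClass {α : Type} (p : α → Plane) : ArrangementClass α :=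
  Quotient.mk _ p

/-- `p` is a realization of the rank 3 matroid `M` (with ground set all of `α`): the points are
distinct, and three of them span the plane exactly when their labels form a basis of `M`;
equivalently, the `3 × 3` minors that vanish are those of the non-bases. -/
def IsRealization {α : Type} (M : Matroid α) (p : α → Plane) : Prop :=
  Function.Injective p ∧
    ∀ i j k : α, i ≠ j → i ≠ k → j ≠ k →
      (M.IsBase {i, j, k} ↔ Projectivization.Independent ![p i, p j, p k])

/-- The set of complex points of the realization space of `M`: classes of realizations up to
projective transformations. -/
def realizationSpace {α : Type} (M : Matroid α) : Set (ArrangementClass α) :=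
  {c | ∃ p : α → Plane, IsRealization M p ∧ arrangementClass p = c}

/-- Bases of the matroid on `ℤ/nℤ`: sets of three elements whose sum is not zero. -/
def IsTorsionBase (n : ℕ) (B : Set (ZMod n)) : Prop :=
  ∃ i j k : ZMod n, i ≠ j ∧ i ≠ k ∧ j ≠ k ∧ i + j + k ≠ 0 ∧ B = {i, j, k}

theorem exists_isTorsionBase (n : ℕ) (hn : 4 ≤ n) :
    ∃ B : Set (ZMod n), IsTorsionBase n B ∧ B.Finite := by
  have key : ∀ m : ℕ, 0 < m → m < 4 → (m : ZMod n) ≠ 0 := by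
    intro m h0 h4 h
    rw [ZMod.natCast_eq_zero_iff] at h
    exact absurd (Nat.le_of_dvd h0 h) (by omega)
  have h1 := key 1 (by norm_num) (by norm_num)
  have h2 := key 2 (by norm_num) (by norm_num)
  have h3 := key 3 (by norm_num) (by norm_num)
  push_cast at h1 h2 h3
  refine ⟨{0, 1, 2}, ⟨0, 1, 2, h1.symm, h2.symm, ?_, ?_, rfl⟩, by simp⟩
  · intro h
    apply h1
    linear_combination -h
  · intro h
    apply h3
    linear_combination h

theorem exchange_isTorsionBase (n : ℕ) : Matroid.ExchangeProperty (IsTorsionBase n) := by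
  -- the removed point may be assumed to come last
  have main : ∀ x y a : ZMod n, x ≠ y → x ≠ a → y ≠ a → ∀ Y, IsTorsionBase n Y → a ∉ Y →
      ∃ b ∈ Y, b ≠ x ∧ b ≠ y ∧ b ≠ a ∧ x + y + b ≠ 0 := by
    rintro x y a hxy hxa hya _ ⟨i, j, k, hij, hik, hjk, hs, rfl⟩ ha
    by_contra! hcon
    simp only [Set.mem_insert_iff, Set.mem_singleton_iff, not_or] at ha hcon
    obtain ⟨hai, haj, hak⟩ := ha
    have hi : i = x ∨ i = y ∨ i = -(x + y) := by
      by_cases h1 : i = x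
      · exact Or.inl h1
      by_cases h2 : i = y
      · exact Or.inr (Or.inl h2)
      · have := hcon i (Or.inl rfl) h1 h2 (Ne.symm hai)
        exact Or.inr (Or.inr (by linear_combination this))
    have hj : j = x ∨ j = y ∨ j = -(x + y) := by
      by_cases h1 : j = x
      · exact Or.inl h1
      by_cases h2 : j = y
      · exact Or.inr (Or.inl h2)
      · have := hcon j (Or.inr (Or.inl rfl)) h1 h2 (Ne.symm haj)
        exact Or.inr (Or.inr (by linear_combination this))
    have hk : k = x ∨ k = y ∨ k = -(x + y) := by
      by_cases h1 : k = x
      · exact Or.inl h1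
      by_cases h2 : k = y
      · exact Or.inr (Or.inl h2)
      · have := hcon k (Or.inr (Or.inr rfl)) h1 h2 (Ne.symm hak)
        exact Or.inr (Or.inr (by linear_combination this))
    rcases hi with rfl | rfl | rfl <;> rcases hj with rfl | rfl | rfl <;>
      rcases hk with rfl | rfl | rfl <;> first
        | exact hij rfl
        | exact hik rfl
        | exact hjk rfl
        | exact hs (by ring)
  have aux : ∀ x y a : ZMod n, x ≠ y → x ≠ a → y ≠ a → ∀ X Y, X = {x, y, a} →
      IsTorsionBase n Y → a ∉ Y → ∃ b ∈ Y \ X, IsTorsionBase n (insert b (X \ {a})) := by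
    rintro x y a hxy hxa hya X Y rfl hY haY
    obtain ⟨b, hbY, hbx, hby, hba, hs⟩ := main x y a hxy hxa hya Y hY haY
    refine ⟨b, ⟨hbY, by simp [hbx, hby, hba]⟩, b, x, y, hbx, hby, hxy, ?_, ?_⟩
    · intro h
      exact hs (by linear_combination h)
    · ext z
      simp only [Set.mem_insert_iff, Set.mem_sdiff, Set.mem_singleton_iff]
      constructor
      · rintro (h | ⟨h | h | h, h'⟩) <;> tauto
      · rintro (h | rfl | rfl) <;> tauto
  rintro X Y ⟨i, j, k, hij, hik, hjk, -, rfl⟩ hY a ⟨haX, haY⟩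
  rcases haX with rfl | rfl | rfl
  · exact aux j k a hjk hij.symm hik.symm _ Y (by ext; simp; tauto) hY haY
  · exact aux i k a hik hij hjk.symm _ Y (by ext; simp; tauto) hY haY
  · exact aux i j a hij hik hjk _ Y rfl hY haY

/-- The rank 3 matroid with ground set `ℤ/nℤ` whose non-bases are the sets of three elements
`{i, j, k}` with `i + j + k = 0`. (For `n ≤ 3` there would be no basis at all.) -/
def torsionMatroid (n : ℕ) (hn : 4 ≤ n) : Matroid (ZMod n) :=
  Matroid.ofExistsFiniteIsBase Set.univ (IsTorsionBase n) (exists_isTorsionBase n hn)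
    (exchange_isTorsionBase n) (fun _ _ => Set.subset_univ _)

/-! ### Elliptic curves with a point of order `n` -/

/-- The standard embedding of (the nonsingular locus of) a Weierstrass curve into the plane. The
neutral element goes to the flex `(0 : 1 : 0)`. -/
def toPlane {W : WeierstrassCurve ℂ} : W.toAffine.Point → Plane
  | .zero => Projectivization.mk ℂ ![0, 1, 0] (fun h => one_ne_zero (congrFun h 1))
  | .some x y _ => Projectivization.mk ℂ ![x, y, 1] (fun h => one_ne_zero (congrFun h 2))

/-- A complex elliptic curve together with a point of exact order `n` on it. -/
structure EllipticPair (n : ℕ) where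
  /-- the elliptic curve -/
  curve : WeierstrassCurve ℂ
  isElliptic : curve.IsElliptic
  /-- the torsion point -/
  point : curve.toAffine.Point
  order : addOrderOf point = n

/-- The admissible change of variables `C`, namely `(x', y') ↦ (u²x' + r, u³y' + u²sx' + t)`,
maps the point `P'` to the point `P`. -/
def MapsPoint (C : WeierstrassCurve.VariableChange ℂ) {W' W : WeierstrassCurve ℂ} :
    W'.toAffine.Point → W.toAffine.Point → Prop
  | .zero, .zero => True
  | .some x' y' _, .some x y _ =>
      x = C.u ^ 2 * x' + C.r ∧ y = C.u ^ 3 * y' + C.u ^ 2 * C.s * x' + C.t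
  | _, _ => False

/-- Isomorphism of pairs: an isomorphism of elliptic curves (an admissible change of Weierstrass
coordinates) that matches the torsion points. -/
def EllipticPair.Iso {n : ℕ} (X X' : EllipticPair n) : Prop :=
  ∃ C : WeierstrassCurve.VariableChange ℂ, X'.curve = C • X.curve ∧
    MapsPoint C X'.point X.point

theorem MapsPoint.one {W : WeierstrassCurve ℂ} (P : W.toAffine.Point) :
    MapsPoint (1 : WeierstrassCurve.VariableChange ℂ) P P := by
  rcases P with _ | ⟨x, y, h⟩
  · trivial
  · simp [MapsPoint, WeierstrassCurve.VariableChange.one_def]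

theorem MapsPoint.inv {C : WeierstrassCurve.VariableChange ℂ} {W' W : WeierstrassCurve ℂ}
    {P' : W'.toAffine.Point} {P : W.toAffine.Point} (h : MapsPoint C P' P) :
    MapsPoint C⁻¹ P P' := by
  rcases P' with _ | ⟨x', y', h'⟩ <;> rcases P with _ | ⟨x, y, h0⟩
  · trivial
  · exact h
  · exact h
  · obtain ⟨hx, hy⟩ := h
    have hu : (C.u : ℂ) ≠ 0 := C.u.ne_zero
    simp only [MapsPoint, WeierstrassCurve.VariableChange.inv_def, Units.val_inv_eq_inv_val]
    constructor
    · rw [hx]; field_simp; ring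
    · rw [hx, hy]; field_simp; ring

theorem MapsPoint.mul {C C' : WeierstrassCurve.VariableChange ℂ} {W'' W' W : WeierstrassCurve ℂ}
    {P'' : W''.toAffine.Point} {P' : W'.toAffine.Point} {P : W.toAffine.Point}
    (h' : MapsPoint C' P'' P') (h : MapsPoint C P' P) : MapsPoint (C' * C) P'' P := by
  rcases P'' with _ | ⟨x'', y'', h2⟩ <;> rcases P' with _ | ⟨x', y', h1⟩ <;>
    rcases P with _ | ⟨x, y, h0⟩
  · trivial
  · exact h.elim
  · exact h'.elim
  · exact h'.elim
  · exact h'.elim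
  · exact h'.elim
  · exact h.elim
  · obtain ⟨hx, hy⟩ := h
    obtain ⟨hx', hy'⟩ := h'
    simp only [MapsPoint, WeierstrassCurve.VariableChange.mul_def, Units.val_mul]
    constructor
    · rw [hx, hx']; ring
    · rw [hy, hx', hy']; ring

theorem EllipticPair.iso_equivalence (n : ℕ) : Equivalence (EllipticPair.Iso (n := n)) where
  refl X := ⟨1, (one_smul _ _).symm, MapsPoint.one _⟩
  symm := by
    rintro X X' ⟨C, hC, h⟩
    exact ⟨C⁻¹, by rw [hC, inv_smul_smul], h.inv⟩
  trans := by
    rintro X X' X'' ⟨C, hC, h⟩ ⟨C', hC', h'⟩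
    exact ⟨C' * C, by rw [hC', hC, mul_smul], h'.mul h⟩

instance EllipticPair.setoid (n : ℕ) : Setoid (EllipticPair n) :=
  ⟨EllipticPair.Iso, EllipticPair.iso_equivalence n⟩

/-- The complex points of the modular curve `X₁(n)` minus its cusps: isomorphism classes of
complex elliptic curves with a point of exact order `n`. -/
def OpenModularCurve (n : ℕ) : Type := Quotient (EllipticPair.setoid n)

theorem negY_variableChange (C : WeierstrassCurve.VariableChange ℂ) (W : WeierstrassCurve ℂ)
    (x y : ℂ) : W.toAffine.negY (C.u ^ 2 * x + C.r) (C.u ^ 3 * y + C.u ^ 2 * C.s * x + C.t) =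
      C.u ^ 3 * (C • W).toAffine.negY x y + C.u ^ 2 * C.s * x + C.t := by
  have hu : (C.u : ℂ) ≠ 0 := C.u.ne_zero
  simp only [WeierstrassCurve.Affine.negY, WeierstrassCurve.variableChange_def,
    Units.val_inv_eq_inv_val]
  field_simp
  ring

theorem negY_eq_iff_variableChange (C : WeierstrassCurve.VariableChange ℂ)
    (W : WeierstrassCurve ℂ) (x y₁ y₂ : ℂ) :
    C.u ^ 3 * y₁ + C.u ^ 2 * C.s * x + C.t =
      W.toAffine.negY (C.u ^ 2 * x + C.r) (C.u ^ 3 * y₂ + C.u ^ 2 * C.s * x + C.t) ↔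
    y₁ = (C • W).toAffine.negY x y₂ := by
  have hu : (C.u : ℂ) ^ 3 ≠ 0 := pow_ne_zero 3 C.u.ne_zero
  rw [negY_variableChange]
  constructor
  · intro h
    exact mul_left_cancel₀ hu (by linear_combination h)
  · intro h
    rw [h]

theorem slope_variableChange (C : WeierstrassCurve.VariableChange ℂ) (W : WeierstrassCurve ℂ)
    (x₁ x₂ y₁ y₂ : ℂ) (h₁ : (C • W).toAffine.Equation x₁ y₁)
    (h₂ : (C • W).toAffine.Equation x₂ y₂)
    (hxy : ¬ (x₁ = x₂ ∧ y₁ = (C • W).toAffine.negY x₂ y₂)) :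
    W.toAffine.slope (C.u ^ 2 * x₁ + C.r) (C.u ^ 2 * x₂ + C.r)
      (C.u ^ 3 * y₁ + C.u ^ 2 * C.s * x₁ + C.t) (C.u ^ 3 * y₂ + C.u ^ 2 * C.s * x₂ + C.t) =
      C.u * (C • W).toAffine.slope x₁ x₂ y₁ y₂ + C.s := by
  have hu : (C.u : ℂ) ≠ 0 := C.u.ne_zero
  by_cases hx : x₁ = x₂
  · subst hx
    have hy : y₁ ≠ (C • W).toAffine.negY x₁ y₂ := fun h => hxy ⟨rfl, h⟩
    obtain rfl := WeierstrassCurve.Affine.Y_eq_of_Y_ne h₁ h₂ rfl hy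
    have hd : y₁ - (C • W).toAffine.negY x₁ y₁ ≠ 0 := sub_ne_zero.mpr hy
    rw [WeierstrassCurve.Affine.slope_of_Y_ne rfl hy, WeierstrassCurve.Affine.slope_of_Y_ne rfl
      (fun h => hy ((negY_eq_iff_variableChange C W x₁ y₁ y₁).mp h)), negY_variableChange]
    have hd' : (C.u ^ 3 * y₁ + C.u ^ 2 * C.s * x₁ + C.t -
        (C.u ^ 3 * (C • W).toAffine.negY x₁ y₁ + C.u ^ 2 * C.s * x₁ + C.t) : ℂ) =
        C.u ^ 3 * (y₁ - (C • W).toAffine.negY x₁ y₁) := by ring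
    rw [hd', div_eq_iff (mul_ne_zero (pow_ne_zero 3 hu) hd)]
    have hq : ((3 * x₁ ^ 2 + 2 * (C • W).a₂ * x₁ + (C • W).a₄ - (C • W).a₁ * y₁) /
        (y₁ - (C • W).toAffine.negY x₁ y₁)) * (y₁ - (C • W).toAffine.negY x₁ y₁) =
        3 * x₁ ^ 2 + 2 * (C • W).a₂ * x₁ + (C • W).a₄ - (C • W).a₁ * y₁ := div_mul_cancel₀ _ hd
    rw [add_mul, show ∀ q d : ℂ, C.u * q * (C.u ^ 3 * d) = C.u ^ 4 * (q * d) by intros; ring, hq]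
    simp only [WeierstrassCurve.Affine.negY, WeierstrassCurve.variableChange_def,
      Units.val_inv_eq_inv_val]
    field_simp
    ring
  · have hx' : (C.u ^ 2 * x₁ + C.r : ℂ) ≠ C.u ^ 2 * x₂ + C.r := fun h =>
      hx (mul_left_cancel₀ (pow_ne_zero 2 hu) (add_right_cancel h))
    have hd : x₁ - x₂ ≠ 0 := sub_ne_zero.mpr hx
    rw [WeierstrassCurve.Affine.slope_of_X_ne hx, WeierstrassCurve.Affine.slope_of_X_ne hx',
      show (C.u ^ 2 * x₁ + C.r - (C.u ^ 2 * x₂ + C.r) : ℂ) = C.u ^ 2 * (x₁ - x₂) by ring]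
    field_simp
    ring

/-- Changes of variables respect addition. -/
theorem MapsPoint.add {C : WeierstrassCurve.VariableChange ℂ} {W : WeierstrassCurve ℂ}
    {A' B' : (C • W).toAffine.Point} {A B : W.toAffine.Point}
    (hA : MapsPoint C A' A) (hB : MapsPoint C B' B) : MapsPoint C (A' + B') (A + B) := by
  have hu : (C.u : ℂ) ≠ 0 := C.u.ne_zero
  rcases A' with _ | ⟨x₁, y₁, h₁⟩ <;> rcases A with _ | ⟨X₁, Y₁, H₁⟩
  · change MapsPoint C (0 + B') (0 + B)
    rwa [zero_add, zero_add]
  · exact hA.elim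
  · exact hA.elim
  rcases B' with _ | ⟨x₂, y₂, h₂⟩ <;> rcases B with _ | ⟨X₂, Y₂, H₂⟩
  · exact hA
  · exact hB.elim
  · exact hB.elim
  obtain ⟨rfl, rfl⟩ := hA
  obtain ⟨rfl, rfl⟩ := hB
  by_cases hxy : x₁ = x₂ ∧ y₁ = (C • W).toAffine.negY x₂ y₂
  · obtain ⟨rfl, hy⟩ := hxy
    rw [WeierstrassCurve.Affine.Point.add_of_Y_eq rfl hy,
      WeierstrassCurve.Affine.Point.add_of_Y_eq rfl
        ((negY_eq_iff_variableChange C W x₁ y₁ y₂).mpr hy)]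
    trivial
  · have hXY : ¬ ((C.u ^ 2 * x₁ + C.r : ℂ) = C.u ^ 2 * x₂ + C.r ∧
        (C.u ^ 3 * y₁ + C.u ^ 2 * C.s * x₁ + C.t : ℂ) =
          W.toAffine.negY (C.u ^ 2 * x₂ + C.r) (C.u ^ 3 * y₂ + C.u ^ 2 * C.s * x₂ + C.t)) := by
      rintro ⟨hx, hy⟩
      obtain rfl : x₁ = x₂ := mul_left_cancel₀ (pow_ne_zero 2 hu) (add_right_cancel hx)
      exact hxy ⟨rfl, (negY_eq_iff_variableChange C W x₁ y₁ y₂).mp hy⟩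
    rw [WeierstrassCurve.Affine.Point.add_some hxy, WeierstrassCurve.Affine.Point.add_some hXY]
    have hX : W.toAffine.addX (C.u ^ 2 * x₁ + C.r) (C.u ^ 2 * x₂ + C.r)
        (C.u * (C • W).toAffine.slope x₁ x₂ y₁ y₂ + C.s) = C.u ^ 2 *
          (C • W).toAffine.addX x₁ x₂ ((C • W).toAffine.slope x₁ x₂ y₁ y₂) + C.r := by
      simp only [WeierstrassCurve.Affine.addX, WeierstrassCurve.variableChange_def,
        Units.val_inv_eq_inv_val]
      field_simp
      ring
    have hs := slope_variableChange C W x₁ x₂ y₁ y₂ h₁.1 h₂.1 hxy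
    refine ⟨by rw [hs, hX], ?_⟩
    rw [hs, WeierstrassCurve.Affine.addY, WeierstrassCurve.Affine.addY,
      ← negY_variableChange, WeierstrassCurve.Affine.negAddY, WeierstrassCurve.Affine.negAddY, hX]
    congr 1
    ring

/-- The projective transformation given by a change of variables. -/
def changeMatrix (C : WeierstrassCurve.VariableChange ℂ) : GL (Fin 3) ℂ :=
  Matrix.GeneralLinearGroup.mkOfDetNeZero
    !![(C.u : ℂ) ^ 2, 0, C.r; C.u ^ 2 * C.s, C.u ^ 3, C.t; 0, 0, 1] (by
      have hu : (C.u : ℂ) ≠ 0 := C.u.ne_zero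
      simp [Matrix.det_fin_three, hu])

theorem MapsPoint.toPlane_eq {C : WeierstrassCurve.VariableChange ℂ} {W' W : WeierstrassCurve ℂ}
    {P' : W'.toAffine.Point} {P : W.toAffine.Point} (h : MapsPoint C P' P) :
    (Matrix.ProjGenLinGroup.mk (changeMatrix C) : PGL(3, ℂ)) • toPlane P' = toPlane P := by
  rcases P' with _ | ⟨x', y', h'⟩ <;> rcases P with _ | ⟨x, y, h0⟩
  · rw [toPlane, toPlane, Projectivization.PGL.mk_smul_mk, Projectivization.mk_eq_mk_iff']
    refine ⟨(C.u : ℂ) ^ 3, ?_⟩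
    ext i
    fin_cases i <;> simp [changeMatrix, Matrix.GeneralLinearGroup.mkOfDetNeZero, Units.smul_def,
      Matrix.smul_eq_mulVec, Matrix.mulVec, dotProduct, Fin.sum_univ_three]
  · exact h.elim
  · exact h.elim
  · obtain ⟨rfl, rfl⟩ := h
    rw [toPlane, toPlane, Projectivization.PGL.mk_smul_mk, Projectivization.mk_eq_mk_iff']
    refine ⟨1, ?_⟩
    ext i
    fin_cases i <;> simp [changeMatrix, Matrix.GeneralLinearGroup.mkOfDetNeZero, Units.smul_def,
      Matrix.smul_eq_mulVec, Matrix.mulVec, dotProduct, Fin.sum_univ_three]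
    ring

/-- The labeled point arrangement `(k t)` for `k ∈ ℤ/nℤ` on the standard plane model. -/
def EllipticPair.arrangement {n : ℕ} (X : EllipticPair n) (k : ZMod n) : Plane :=
  toPlane (k.val • X.point)

theorem EllipticPair.arrangementClass_eq {n : ℕ} (X X' : EllipticPair n) (h : X.Iso X') :
    arrangementClass X.arrangement = arrangementClass X'.arrangement := by
  obtain ⟨W, hW, P, hP⟩ := X
  obtain ⟨W', hW', P', hP'⟩ := X'
  obtain ⟨C, hC, h⟩ := h
  dsimp only at hC h
  subst hC
  have hk : ∀ m : ℕ, MapsPoint C (m • P') (m • P) := by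
    intro m
    induction m with
    | zero => rw [zero_nsmul, zero_nsmul]; trivial
    | succ m ih => rw [succ_nsmul, succ_nsmul]; exact ih.add h
  refine Quotient.sound ?_
  change _ ∈ MulAction.orbit _ _
  exact ⟨Matrix.ProjGenLinGroup.mk (changeMatrix C), funext fun k => (hk k.val).toPlane_eq⟩

/-- The map sending the class of `(E, t)` to the class of the arrangement `(k t)`, for
`k ∈ ℤ/nℤ`. -/
def phi (n : ℕ) : OpenModularCurve n → ArrangementClass (ZMod n) :=
  Quotient.lift (fun X => arrangementClass X.arrangement) EllipticPair.arrangementClass_eq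

/-! ### The explicit configurations on nodal cubics -/

/-- The explicit configuration attached to an integer `a`, where `ζ = exp (2πi/n)`. -/
def nodalConfig (n a : ℕ) (k : ZMod n) : Plane :=
  let ζ : ℂ := Complex.exp (2 * Real.pi * Complex.I / n)
  let e : ℤ → ℂ := fun m => ζ ^ ((a : ℤ) * m)
  let κ : ℤ := (k.val : ℤ)
  if k = 1 then Projectivization.mk ℂ ![0, 1, 0] (fun h => one_ne_zero (congrFun h 1))
  else if k = 2 then Projectivization.mk ℂ ![0, 0, 1] (fun h => one_ne_zero (congrFun h 2))
  else if k = -3 then Projectivization.mk ℂ ![0, 1, 1] (fun h => one_ne_zero (congrFun h 2))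
  else Projectivization.mk ℂ
    ![1,
      ((1 - e 2) * (1 + e 3) * (1 - e κ) * (1 - e (κ + 2))) /
        ((1 - e 5) * (1 - e (κ - 1)) * (1 - e (κ + 3))),
      ((1 - e 1 + e 2) * (1 - e κ) * (1 - e (κ + 1))) /
        ((1 + e 2) * (1 - e (κ - 2)) * (1 - e (κ + 3)))]
    (fun h => one_ne_zero (congrFun h 0))

/-- The finite set of classes of the explicit configurations, for `a` modulo `n` coprime to
`n`. -/
def nodalPoints (n : ℕ) : Set (ArrangementClass (ZMod n)) :=
  {c | ∃ a : ℕ, a < n ∧ Nat.gcd a n = 1 ∧ arrangementClass (nodalConfig n a) = c}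

/-! ### Plane cubics -/

/-- `F` is a nonzero cubic form vanishing at all the points `p k`, and it is unique up to a
scalar. (Vanishing of a form does not depend on the representative of a point.) -/
structure IsUniqueCubicThrough {α : Type} (F : MvPolynomial (Fin 3) ℂ) (p : α → Plane) :
    Prop where
  isHomogeneous : F.IsHomogeneous 3
  ne_zero : F ≠ 0
  vanishes : ∀ k, MvPolynomial.eval (p k).rep F = 0
  unique : ∀ G : MvPolynomial (Fin 3) ℂ, G.IsHomogeneous 3 →
    (∀ k, MvPolynomial.eval (p k).rep G = 0) → ∃ c : ℂ, G = c • F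

/-- The vector `v` represents a singular point of the curve `F = 0`, if it is nonzero. -/
def IsSingularAt (F : MvPolynomial (Fin 3) ℂ) (v : Fin 3 → ℂ) : Prop :=
  MvPolynomial.eval v F = 0 ∧ ∀ i, MvPolynomial.eval v (MvPolynomial.pderiv i F) = 0

/-- The plane curve `F = 0` is smooth. -/
def IsSmoothCurve (F : MvPolynomial (Fin 3) ℂ) : Prop :=
  ∀ v : Fin 3 → ℂ, v ≠ 0 → ¬ IsSingularAt F v

/-- The plane cubic `F = 0` is nodal: it has exactly one singular point, and this point is an
ordinary double point (the Hessian matrix, which kills `v`, has rank 2 there, so that there are two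
distinct tangent lines). Such a cubic is automatically irreducible, since the components of a
reducible cubic meet in several points, or in a point that is not an ordinary double point. -/
def IsNodalCubic (F : MvPolynomial (Fin 3) ℂ) : Prop :=
  ∃ v : Fin 3 → ℂ, v ≠ 0 ∧ IsSingularAt F v ∧ (∀ w, IsSingularAt F w → ∃ c : ℂ, w = c • v) ∧
    (Matrix.of fun i j => MvPolynomial.eval v
      (MvPolynomial.pderiv i (MvPolynomial.pderiv j F))).rank = 2

/-- The points `p k`, `k ∈ ℤ/nℤ`, are smooth points of the cubic `F = 0`, the point `p 0` is a flex,
and for the group law on the smooth points with neutral element `p 0` the points form a cyclic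
subgroup of order `n` with `p k = k • p 1`: some linear change of coordinates `g` carries `F` to
a Weierstrass cubic (possibly singular), and the points to the multiples of a point of order `n` in
the group of its nonsingular points. -/
def FormsCyclicSubgroup {n : ℕ} (F : MvPolynomial (Fin 3) ℂ) (p : ZMod n → Plane) : Prop :=
  ∃ (g : GL (Fin 3) ℂ) (W : WeierstrassCurve ℂ) (P : W.toAffine.Point),
    (∃ c : ℂ, c ≠ 0 ∧ ∀ v : Fin 3 → ℂ,
      MvPolynomial.eval (g.val.mulVec v) W.toProjective.polynomial =
        c * MvPolynomial.eval v F) ∧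
    addOrderOf P = n ∧
    ∀ k : ZMod n, (Matrix.ProjGenLinGroup.mk g : PGL(3, ℂ)) • p k = toPlane (k.val • P)

end TorsionArrangement

end

/-! The collinearities alone force the points onto a Weierstrass cubic. Being a realization is first
expressed by vanishing determinants (`IsTorsionConfig`). The labels from -2 to 2 fix a projective
frame, and the prescribed lines then determine the points with labels -4, …, 5 up to two parameters
`r`, `s` (`IsTorsionConfig.exists_normalForm`). The Tate normal form also has two parameters, and an
explicit linear map carries the points with |m| ≤ 4 to the multiples of (0, 0) on a Tate curve
(`IsNormalForm.exists_weierstrass`).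

Every further point is the intersection of two lines through earlier points, and the chord law puts
the corresponding multiple on the same two lines, so all points lie on the cubic
(`IsTorsionConfig.eq_multiples`). Three distinct nonsingular points are collinear exactly when their
sum is zero, even if the cubic is singular. The labeling is therefore an injective map from ℤ/n
whose values at three distinct labels of sum zero add up to zero, and such a map is a homomorphism
(`hom_of_sum_eq_zero`). This gives a point of exact order n.

If Δ ≠ 0, this is a pair (E, t). If Δ = 0, the nonsingular points form the additive group ℂ (cusp)
or the multiplicative group ℂˣ (node). The first is torsion-free, hence impossible. In the second
the points are the powers of a primitive n-th root of unity on one standard nodal cubic, and a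
change of coordinates gives the explicit formulas (`exists_nodalParam_of_Δ_eq_zero`,
`arrangementClass_mem_nodalPoints_iff`). Conversely, the chord law shows that both kinds are
realizations.

The cubic is unique: one that passes also through another point of the line of `p 0`, `p 1`, `p
(-1)` contains that line, and no conic passes through six of the remaining points
(`IsNormalForm.eval_eq_zero`). Smoothness and nodality are thus properties of the configuration, and
they exclude each other. -/

namespace TorsionArrangement

/-! ### Homogeneous coordinates -/

/-- `v` is a vector of homogeneous coordinates of the point `x`. -/
def Reps (x : Plane) (v : Fin 3 → ℂ) : Prop :=
  ∃ h : v ≠ 0, x = Projectivization.mk ℂ v h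

/-- The determinant of three vectors. -/
def det3 (u v w : Fin 3 → ℂ) : ℂ :=
  u 0 * (v 1 * w 2 - v 2 * w 1) - u 1 * (v 0 * w 2 - v 2 * w 0) + u 2 * (v 0 * w 1 - v 1 * w 0)

theorem det3_eq_det (u v w : Fin 3 → ℂ) : det3 u v w = Matrix.det (Matrix.of ![u, v, w]) := by
  simp [det3, Matrix.det_fin_three]
  ring

theorem det3_mulVec (M : Matrix (Fin 3) (Fin 3) ℂ) (u v w : Fin 3 → ℂ) :
    det3 (M.mulVec u) (M.mulVec v) (M.mulVec w) = M.det * det3 u v w := by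
  simp only [det3, Matrix.mulVec, dotProduct, Fin.sum_univ_three, Matrix.det_fin_three]
  ring

theorem det3_smul (a b c : ℂ) (u v w : Fin 3 → ℂ) :
    det3 (a • u) (b • v) (c • w) = a * b * c * det3 u v w := by
  simp only [det3, Pi.smul_apply, smul_eq_mul]
  ring

/-- Cramer's rule. -/
theorem det3_smul_eq (a b c u : Fin 3 → ℂ) :
    det3 a b c • u = det3 u b c • a + det3 a u c • b + det3 a b u • c := by
  ext i
  fin_cases i <;> simp [det3] <;> ring

theorem reps_rep (x : Plane) : Reps x x.rep :=
  ⟨x.rep_nonzero, x.mk_rep.symm⟩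

theorem reps_mk {v : Fin 3 → ℂ} (h : v ≠ 0) : Reps (Projectivization.mk ℂ v h) v := ⟨h, rfl⟩

theorem Reps.ne_zero {x : Plane} {v : Fin 3 → ℂ} (h : Reps x v) : v ≠ 0 := h.1

theorem Reps.eq {x y : Plane} {v : Fin 3 → ℂ} (h : Reps x v) (h' : Reps y v) : x = y := by
  rw [h.2, h'.2]

theorem Reps.smul {x : Plane} {v : Fin 3 → ℂ} (h : Reps x v) {c : ℂ} (hc : c ≠ 0) :
    Reps x (c • v) := by
  obtain ⟨h0, rfl⟩ := h
  refine ⟨smul_ne_zero hc h0, ?_⟩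
  rw [Projectivization.mk_eq_mk_iff']
  exact ⟨c⁻¹, by rw [smul_smul, inv_mul_cancel₀ hc, one_smul]⟩

theorem Reps.of_smul {x : Plane} {u v : Fin 3 → ℂ} (h : Reps x u) (c : ℂ) (hc : c ≠ 0)
    (hv : v = c • u) : Reps x v := hv ▸ h.smul hc

theorem Reps.exists_smul {x : Plane} {u v : Fin 3 → ℂ} (h : Reps x u) (h' : Reps x v) :
    ∃ c : ℂ, c ≠ 0 ∧ v = c • u := by
  obtain ⟨hu, rfl⟩ := h
  obtain ⟨hv, h⟩ := h'
  rw [Projectivization.mk_eq_mk_iff'] at h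
  obtain ⟨a, rfl⟩ := h
  have ha : a ≠ 0 := by
    rintro rfl
    simp at hu
  exact ⟨a⁻¹, inv_ne_zero ha, by rw [smul_smul, inv_mul_cancel₀ ha, one_smul]⟩

theorem Reps.mk_smul {x : Plane} {v : Fin 3 → ℂ} (h : Reps x v) (g : GL (Fin 3) ℂ) :
    Reps ((Matrix.ProjGenLinGroup.mk g : PGL(3, ℂ)) • x) (g.val.mulVec v) := by
  obtain ⟨h0, rfl⟩ := h
  exact ⟨_, Projectivization.PGL.mk_smul_mk g h0⟩

theorem independent_iff_det3_ne_zero {x y z : Plane} {u v w : Fin 3 → ℂ} (hu : Reps x u)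
    (hv : Reps y v) (hw : Reps z w) :
    Projectivization.Independent ![x, y, z] ↔ det3 u v w ≠ 0 := by
  obtain ⟨a, ha, hu⟩ := (reps_rep x).exists_smul hu
  obtain ⟨b, hb, hv⟩ := (reps_rep y).exists_smul hv
  obtain ⟨c, hc, hw⟩ := (reps_rep z).exists_smul hw
  subst hu hv hw
  rw [Projectivization.independent_iff, det3_smul, mul_ne_zero_iff,
    and_iff_right (mul_ne_zero (mul_ne_zero ha hb) hc), det3_eq_det, ← isUnit_iff_ne_zero,
    ← Matrix.isUnit_iff_isUnit_det, ← Matrix.linearIndependent_rows_iff_isUnit]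
  have : Projectivization.rep ∘ ![x, y, z] = (Matrix.of ![x.rep, y.rep, z.rep]).row := by
    ext i j
    fin_cases i <;> rfl
  rw [this]

theorem Reps.det3_eq_zero_iff {x y z : Plane} {u v w u' v' w' : Fin 3 → ℂ} (hu : Reps x u)
    (hv : Reps y v) (hw : Reps z w) (hu' : Reps x u') (hv' : Reps y v') (hw' : Reps z w') :
    det3 u v w = 0 ↔ det3 u' v' w' = 0 := by
  rw [← not_iff_not, ← ne_eq, ← ne_eq, ← independent_iff_det3_ne_zero hu hv hw,
    independent_iff_det3_ne_zero hu' hv' hw']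

/-- Two lines through pairs of points of an arrangement meet in a single point. -/
theorem Reps.eq_of_det3 {x : Plane} {a b c d u v : Fin 3 → ℂ} (hx : Reps x u) (hv : v ≠ 0)
    (habc : det3 a b c ≠ 0) (hcda : det3 c d a ≠ 0)
    (h1 : det3 a b u = 0) (h2 : det3 c d u = 0) (h3 : det3 a b v = 0) (h4 : det3 c d v = 0) :
    Reps x v := by
  have hu := hx.ne_zero
  -- a vector on both lines is a multiple of a fixed vector
  have key : ∀ u, det3 a b u = 0 → det3 c d u = 0 →
      u = (det3 a u c / (det3 a b c * det3 c d a)) • (det3 c d a • b - det3 c d b • a) := by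
    intro u h1 h2
    have hcr := det3_smul_eq a b c u
    rw [h1, zero_smul, add_zero] at hcr
    have hlin : det3 u b c * det3 c d a + det3 a u c * det3 c d b = 0 := by
      have h := congrArg (det3 c d) hcr
      have e1 : det3 c d (det3 a b c • u) = det3 a b c * det3 c d u := by
        simp only [det3, Pi.smul_apply, smul_eq_mul]; ring
      have e2 : det3 c d (det3 u b c • a + det3 a u c • b) =
          det3 u b c * det3 c d a + det3 a u c * det3 c d b := by
        simp only [det3, Pi.smul_apply, Pi.add_apply, smul_eq_mul]; ring
      rw [e1, e2, h2, mul_zero] at h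
      exact h.symm
    ext i
    have hi := congrFun hcr i
    simp only [Pi.smul_apply, Pi.add_apply, Pi.sub_apply, smul_eq_mul] at hi ⊢
    rw [div_mul_eq_mul_div, eq_div_iff (mul_ne_zero habc hcda)]
    linear_combination det3 c d a * hi + a i * hlin
  have hu' := key u h1 h2
  have hv' := key v h3 h4
  set m := det3 c d a • b - det3 c d b • a
  set α := det3 a u c / (det3 a b c * det3 c d a)
  set β := det3 a v c / (det3 a b c * det3 c d a)
  have hα : α ≠ 0 := fun h => hu (by rw [hu', h, zero_smul])
  have hβ : β ≠ 0 := fun h => hv (by rw [hv', h, zero_smul])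
  refine hx.of_smul (β / α) (div_ne_zero hβ hα) ?_
  conv_rhs => rw [hu']
  rw [smul_smul, div_mul_cancel₀ _ hα]
  exact hv'

theorem exists_mk_smul_eq_of_arrangementClass_eq {α : Type} {p q : α → Plane}
    (h : arrangementClass p = arrangementClass q) :
    ∃ g : GL (Fin 3) ℂ, ∀ k, (Matrix.ProjGenLinGroup.mk g : PGL(3, ℂ)) • p k = q k := by
  have h' := Quotient.exact h.symm
  obtain ⟨g, hg⟩ : _ ∈ MulAction.orbit _ _ := h'
  obtain ⟨g, rfl⟩ := Matrix.ProjGenLinGroup.mk_surjective g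
  exact ⟨g, fun k => congrFun hg k⟩

theorem arrangementClass_eq_of_mk_smul_eq {α : Type} {p q : α → Plane} (g : GL (Fin 3) ℂ)
    (h : ∀ k, (Matrix.ProjGenLinGroup.mk g : PGL(3, ℂ)) • p k = q k) :
    arrangementClass p = arrangementClass q := by
  refine (Quotient.sound ?_ : arrangementClass q = arrangementClass p).symm
  change _ ∈ MulAction.orbit _ _
  exact ⟨Matrix.ProjGenLinGroup.mk g, funext h⟩

/-! ### Realizations in terms of determinants -/

/-- Points `p i`, `p j`, `p k` with distinct labels are collinear iff `i + j + k = 0`. -/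
def IsTorsionConfig {n : ℕ} (p : ZMod n → Plane) : Prop :=
  ∀ i j k : ZMod n, i ≠ j → i ≠ k → j ≠ k →
    (det3 (p i).rep (p j).rep (p k).rep = 0 ↔ i + j + k = 0)

theorem IsTorsionConfig.det3_eq_zero_iff {n : ℕ} {p : ZMod n → Plane} (hp : IsTorsionConfig p)
    {i j k : ZMod n} (hij : i ≠ j) (hik : i ≠ k) (hjk : j ≠ k) {u v w : Fin 3 → ℂ}
    (hu : Reps (p i) u) (hv : Reps (p j) v) (hw : Reps (p k) w) :
    det3 u v w = 0 ↔ i + j + k = 0 :=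
  (hu.det3_eq_zero_iff hv hw (reps_rep _) (reps_rep _) (reps_rep _)).trans (hp i j k hij hik hjk)

theorem isTorsionConfig_of_reps {n : ℕ} {p : ZMod n → Plane} {v : ZMod n → Fin 3 → ℂ}
    (h : ∀ k, Reps (p k) (v k))
    (hv : ∀ i j k : ZMod n, i ≠ j → i ≠ k → j ≠ k → (det3 (v i) (v j) (v k) = 0 ↔ i + j + k = 0)) :
    IsTorsionConfig p := fun i j k hij hik hjk =>
  ((reps_rep _).det3_eq_zero_iff (reps_rep _) (reps_rep _) (h i) (h j) (h k)).trans
    (hv i j k hij hik hjk)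

theorem IsTorsionConfig.mk_smul {n : ℕ} {p q : ZMod n → Plane} (hp : IsTorsionConfig p)
    (g : GL (Fin 3) ℂ) (h : ∀ k, (Matrix.ProjGenLinGroup.mk g : PGL(3, ℂ)) • p k = q k) :
    IsTorsionConfig q := by
  refine isTorsionConfig_of_reps (v := fun k => g.val.mulVec (p k).rep)
    (fun k => h k ▸ (reps_rep (p k)).mk_smul g) ?_
  intro i j k hij hik hjk
  have hg : g.val.det ≠ 0 := (Matrix.isUnit_iff_isUnit_det _).mp g.isUnit |>.ne_zero
  rw [det3_mulVec, mul_eq_zero, or_iff_right hg, hp i j k hij hik hjk]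

theorem intCast_ne {n : ℕ} {a b : ℤ} (hab : a ≠ b) (h1 : a - b < n) (h2 : b - a < n) :
    (a : ZMod n) ≠ (b : ZMod n) := by
  intro h
  rw [ZMod.intCast_eq_intCast_iff_dvd_sub] at h
  have h0 : b - a = 0 := Int.eq_zero_of_abs_lt_dvd h (abs_lt.mpr ⟨by linarith, by linarith⟩)
  exact hab (by linarith)

/-- If two labels i ≠ j shared a point, every third point would be collinear with them, so every
third label would equal -(i + j); there are too many labels for that. -/
theorem IsTorsionConfig.injective {n : ℕ} (hn : 10 ≤ n) {p : ZMod n → Plane}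
    (hp : IsTorsionConfig p) : Function.Injective p := by
  intro i j hij
  by_contra hne
  have : NeZero n := ⟨by omega⟩
  obtain ⟨k, hk⟩ : ∃ k : ZMod n, k ∉ ({i, j, -(i + j)} : Finset (ZMod n)) := by
    by_contra! h
    have h1 := Finset.card_le_card (fun k _ => h k : (Finset.univ : Finset (ZMod n)) ⊆ _)
    rw [Finset.card_univ, ZMod.card] at h1
    exact absurd (h1.trans Finset.card_le_three) (by omega)
  simp only [Finset.mem_insert, Finset.mem_singleton, not_or] at hk
  refine hk.2.2 ?_
  have h := (hp i j k hne (Ne.symm hk.1) (Ne.symm hk.2.1)).mp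
    (by rw [hij]; simp only [det3]; ring)
  linear_combination h

theorem torsionMatroid_isBase_iff {n : ℕ} (hn : 4 ≤ n) {i j k : ZMod n} (hij : i ≠ j)
    (hik : i ≠ k) (hjk : j ≠ k) :
    (torsionMatroid n hn).IsBase {i, j, k} ↔ i + j + k ≠ 0 := by
  classical
  change IsTorsionBase n _ ↔ _
  constructor
  · rintro ⟨a, b, c, hab, hac, hbc, hs, h⟩
    have h' : ({i, j, k} : Finset (ZMod n)) = {a, b, c} := by
      apply Finset.coe_injective
      simpa using h
    -- The sum over the underlying finite set does not depend on how its elements are listed.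
    have h2 := congrArg (fun s => ∑ x ∈ s, x) h'
    rw [Finset.sum_insert (by simp [hij, hik]), Finset.sum_insert (by simp [hjk]),
      Finset.sum_singleton, Finset.sum_insert (by simp [hab, hac]),
      Finset.sum_insert (by simp [hbc]), Finset.sum_singleton] at h2
    rw [add_assoc, h2, ← add_assoc]
    exact hs
  · intro hs
    exact ⟨i, j, k, hij, hik, hjk, hs, rfl⟩

theorem isRealization_iff {n : ℕ} (hn : 10 ≤ n) (hn' : 4 ≤ n) (p : ZMod n → Plane) :
    IsRealization (torsionMatroid n hn') p ↔ IsTorsionConfig p := by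
  constructor
  · rintro ⟨-, h⟩ i j k hij hik hjk
    have h1 := h i j k hij hik hjk
    rw [torsionMatroid_isBase_iff hn' hij hik hjk,
      independent_iff_det3_ne_zero (reps_rep _) (reps_rep _) (reps_rep _)] at h1
    exact not_iff_not.mp h1.symm
  · intro h
    refine ⟨h.injective hn, fun i j k hij hik hjk => ?_⟩
    rw [torsionMatroid_isBase_iff hn' hij hik hjk,
      independent_iff_det3_ne_zero (reps_rep _) (reps_rep _) (reps_rep _)]
    exact not_iff_not.mpr (h i j k hij hik hjk).symm

/-! ### Collinear points of Weierstrass cubics -/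

/-- Homogeneous coordinates of a nonsingular point of a Weierstrass curve. -/
def coords {W : WeierstrassCurve ℂ} : W.toAffine.Point → Fin 3 → ℂ
  | .zero => ![0, 1, 0]
  | .some x y _ => ![x, y, 1]

theorem reps_toPlane {W : WeierstrassCurve ℂ} (P : W.toAffine.Point) :
    Reps (toPlane P) (coords P) := by
  rcases P with _ | ⟨x, y, h⟩
  · exact reps_mk _
  · exact reps_mk _

theorem toPlane_injective {W : WeierstrassCurve ℂ} :
    Function.Injective (toPlane : W.toAffine.Point → Plane) := by
  intro P Q h
  obtain ⟨c, hc, h⟩ := (reps_toPlane P).exists_smul (h ▸ reps_toPlane Q)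
  rcases P with _ | ⟨x, y, hP⟩ <;> rcases Q with _ | ⟨x', y', hQ⟩
  · rfl
  · have := congrFun h 2
    simp [coords] at this
  · have := congrFun h 2
    simp [coords] at this
    exact absurd this.symm hc
  · have h2 := congrFun h 2
    simp [coords] at h2
    subst h2
    have h0 := congrFun h 0
    have h1 := congrFun h 1
    simp [coords] at h0 h1
    subst h0 h1
    rfl

/-- The chord law for any Weierstrass curve, singular or not. Coinciding points are allowed, since
the determinant then vanishes trivially. -/
theorem det3_coords_of_add_eq_zero {W : WeierstrassCurve ℂ} {P Q R : W.toAffine.Point}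
    (h : P + Q + R = 0) : det3 (coords P) (coords Q) (coords R) = 0 := by
  obtain rfl : R = -(P + Q) := (neg_eq_of_add_eq_zero_right h).symm
  rcases P with _ | ⟨x, y, hP⟩
  · rcases Q with _ | ⟨x', y', hQ⟩
    · simp [coords, det3]
    · change det3 (coords 0) _ (coords (-(0 + _))) = 0
      rw [zero_add, WeierstrassCurve.Affine.Point.neg_some]
      change det3 ![0, 1, 0] ![_, _, _] ![_, _, _] = 0
      simp [det3]
  rcases Q with _ | ⟨x', y', hQ⟩
  · change det3 _ (coords 0) (coords (-(_ + 0))) = 0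
    rw [add_zero, WeierstrassCurve.Affine.Point.neg_some]
    change det3 ![_, _, _] ![0, 1, 0] ![_, _, _] = 0
    simp [det3]
  by_cases hx : x = x'
  · subst hx
    rcases WeierstrassCurve.Affine.Y_eq_of_X_eq hP.1 hQ.1 rfl with rfl | hy
    · simp [coords, det3]; ring
    · rw [WeierstrassCurve.Affine.Point.add_of_Y_eq rfl hy, neg_zero]
      change det3 ![_, _, _] ![_, _, _] ![0, 1, 0] = 0
      simp [det3]
  · rw [WeierstrassCurve.Affine.Point.add_some (fun h => hx h.1),
      WeierstrassCurve.Affine.Point.neg_some]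
    simp only [coords]
    rw [WeierstrassCurve.Affine.addY, WeierstrassCurve.Affine.negY_negY,
      WeierstrassCurve.Affine.slope_of_X_ne hx, WeierstrassCurve.Affine.negAddY]
    have hd : x - x' ≠ 0 := sub_ne_zero.mpr hx
    set X := W.toAffine.addX x x' ((y - y') / (x - x'))
    simp only [det3, Matrix.cons_val]
    field_simp
    ring

/-- A line through two of the points meets the cubic in only one further point, counted with
multiplicity. Distinctness is essential: a repeated point makes the determinant vanish without being
a tangency. -/
theorem add_eq_zero_of_det3_coords {W : WeierstrassCurve ℂ} {P Q R : W.toAffine.Point}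
    (hPQ : P ≠ Q) (hPR : P ≠ R) (hQR : Q ≠ R) (h : det3 (coords P) (coords Q) (coords R) = 0) :
    P + Q + R = 0 := by
  -- two points on a vertical line
  have vert : ∀ {x y x' y' : ℂ} (hP : W.toAffine.Nonsingular x y)
      (hQ : W.toAffine.Nonsingular x' y'), WeierstrassCurve.Affine.Point.some x y hP ≠ .some x' y' hQ →
      x = x' → WeierstrassCurve.Affine.Point.some x y hP + .some x' y' hQ = 0 := by
    rintro x y x' y' hP hQ hne rfl
    rcases WeierstrassCurve.Affine.Y_eq_of_X_eq hP.1 hQ.1 rfl with rfl | hy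
    · exact absurd rfl hne
    · exact WeierstrassCurve.Affine.Point.add_of_Y_eq rfl hy
  rcases P with _ | ⟨x, y, hP⟩ <;> rcases Q with _ | ⟨x', y', hQ⟩
  · exact absurd rfl hPQ
  · rcases R with _ | ⟨x'', y'', hR⟩
    · exact absurd rfl hPR
    · change 0 + _ + _ = _
      rw [zero_add]
      refine vert _ _ hQR ?_
      simp [coords, det3] at h
      linear_combination -h
  · rcases R with _ | ⟨x'', y'', hR⟩
    · exact absurd rfl hQR
    · change _ + 0 + _ = _
      rw [add_zero]
      refine vert _ _ hPR ?_
      simp [coords, det3] at h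
      linear_combination h
  · rcases R with _ | ⟨x'', y'', hR⟩
    · change _ + _ + 0 = _
      rw [add_zero]
      refine vert _ _ hPQ ?_
      simp [coords, det3] at h
      linear_combination -h
    by_cases hx : x = x'
    · subst hx
      have hy : y ≠ y' := by
        rintro rfl
        exact hPQ rfl
      have hx' : x = x'' := by
        simp only [coords, det3, Matrix.cons_val] at h
        have : (y' - y) * (x'' - x) = 0 := by linear_combination -h
        rcases mul_eq_zero.mp this with h1 | h1
        · exact absurd (by linear_combination -h1) hy
        · linear_combination -h1
      have h1 := vert _ _ hPQ rfl
      have h2 := vert _ _ hPR hx'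
      exact absurd (add_left_cancel (h1.trans h2.symm)) hQR
    · have hd : x - x' ≠ 0 := sub_ne_zero.mpr hx
      set ℓ := (y - y') / (x - x') with hℓ
      have hℓ' : ℓ * (x - x') = y - y' := div_mul_cancel₀ _ hd
      have hy' : y' = ℓ * (x' - x) + y := by linear_combination hℓ'
      have hy'' : y'' = ℓ * (x'' - x) + y := by
        simp only [coords, det3, Matrix.cons_val] at h
        apply mul_left_cancel₀ hd
        linear_combination -h - (x'' - x) * hℓ'
      have hroot : (x'' - x) * (x'' - x') *
          (x'' - W.toAffine.addX x x' ℓ) = 0 := by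
        -- On the line y = ℓ(x - x₁) + y₁ the Weierstrass equation is a cubic in x that splits with
        -- roots x₁, x₂ and the abscissa `addX` of the sum, so x'' is one of the three.
        have ha := WeierstrassCurve.Affine.addPolynomial_slope hP.1 hQ.1 (fun h => hx h.1)
        rw [WeierstrassCurve.Affine.slope_of_X_ne hx, ← hℓ] at ha
        have hb := congrArg (Polynomial.eval x'') ha
        have hR1 := (W.toAffine.equation_iff _ _).mp hR.1
        rw [WeierstrassCurve.Affine.addPolynomial_eq] at hb
        simp [Cubic.toPoly] at hb
        subst hy''
        simp only [WeierstrassCurve.Affine.addX]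
        linear_combination hb - hR1
      rcases mul_eq_zero.mp hroot with h1 | h1
      · rcases mul_eq_zero.mp h1 with h1 | h1
        · obtain rfl : x'' = x := by linear_combination h1
          obtain rfl : y'' = y := by rw [hy'']; ring
          exact absurd rfl hPR
        · obtain rfl : x'' = x' := by linear_combination h1
          obtain rfl : y'' = y' := by rw [hy'', hy']
          exact absurd rfl hQR
      · have hx'' : x'' = W.toAffine.addX x x' ℓ := by linear_combination h1
        rw [add_eq_zero_iff_neg_eq, WeierstrassCurve.Affine.Point.add_some (fun h => hx h.1),
          WeierstrassCurve.Affine.Point.neg_some]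
        rw [WeierstrassCurve.Affine.Point.some.injEq, WeierstrassCurve.Affine.addY,
          WeierstrassCurve.Affine.negY_negY, WeierstrassCurve.Affine.slope_of_X_ne hx, ← hℓ]
        exact ⟨hx''.symm, by rw [hy'', hx'', WeierstrassCurve.Affine.negAddY]⟩

/-- Multiples of a point of order `n` on a Weierstrass curve form a torsion configuration. -/
theorem isTorsionConfig_multiples {n : ℕ} (hn : 10 ≤ n) {W : WeierstrassCurve ℂ}
    (P : W.toAffine.Point) (hP : addOrderOf P = n) :
    IsTorsionConfig (fun k : ZMod n => toPlane (k.val • P)) := by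
  have : NeZero n := ⟨by omega⟩
  have hzero : ∀ m : ℕ, m • P = 0 ↔ (m : ZMod n) = 0 := by
    intro m
    rw [← addOrderOf_dvd_iff_nsmul_eq_zero, hP, ZMod.natCast_eq_zero_iff]
  have hinj : ∀ i j : ZMod n, i ≠ j → i.val • P ≠ j.val • P := by
    intro i j hij h
    apply hij
    have h1 : (i.val + (-j).val) • P = 0 := by
      rw [add_nsmul, h, ← add_nsmul, hzero]
      push_cast
      simp
    rw [hzero] at h1
    push_cast at h1
    simpa [add_neg_eq_zero] using h1
  have hsum : ∀ i j k : ZMod n, i.val • P + j.val • P + k.val • P = 0 ↔ i + j + k = 0 := by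
    intro i j k
    rw [← add_nsmul, ← add_nsmul, hzero]
    push_cast
    simp
  refine isTorsionConfig_of_reps (fun k => reps_toPlane _) ?_
  intro i j k hij hik hjk
  rw [← hsum]
  exact ⟨add_eq_zero_of_det3_coords (hinj _ _ hij) (hinj _ _ hik) (hinj _ _ hjk),
    det3_coords_of_add_eq_zero⟩

/-! ### Cyclic families in abelian groups -/

/-- The bound n + 1, rather than n, makes the positive and the negative range overlap modulo n for
odd n too. A residue reached from both sides gives n • P = 0. -/
theorem nsmul_eq_zero_and_eq_val_nsmul {n : ℕ} (hn : 1 ≤ n) {G : Type*} [AddCommGroup G]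
    {f : ZMod n → G} {P : G}
    (h : ∀ m : ℕ, 2 * m ≤ n + 1 → f (m : ℤ) = m • P ∧ f (-m : ℤ) = -(m • P)) :
    n • P = 0 ∧ ∀ k, f k = k.val • P := by
  have : NeZero n := ⟨by omega⟩
  have hn0 : n • P = 0 := by
    -- The residue a is also that of -(n - a), so a • P = -((n - a) • P).
    set a := (n + 1) / 2 with ha
    have h1 := (h a (by omega)).1
    have h2 := (h (n - a) (by omega)).2
    have he : ((a : ℤ) : ZMod n) = ((-((n - a : ℕ) : ℤ) : ℤ) : ZMod n) := by
      have hc : ((n - a : ℕ) : ℤ) = n - a := by omega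
      rw [hc]
      push_cast
      simp
    rw [he, h2] at h1
    have hna : n = a + (n - a) := by omega
    rw [hna, add_nsmul, ← h1, neg_add_cancel]
  refine ⟨hn0, fun k => ?_⟩
  have hk : ((k.val : ℕ) : ZMod n) = k := ZMod.natCast_zmod_val k
  have hlt := k.val_lt
  by_cases hle : 2 * k.val ≤ n + 1
  · have h1 := (h _ hle).1
    rwa [Int.cast_natCast, hk] at h1
  · have h2 := (h (n - k.val) (by omega)).2
    have hc : ((n - k.val : ℕ) : ℤ) = n - k.val := by omega
    rw [hc] at h2
    push_cast at h2
    rw [hk] at h2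
    have h3 : k.val • P + (n - k.val) • P = 0 := by
      rw [← add_nsmul, Nat.add_sub_cancel' hlt.le, hn0]
    rw [← eq_neg_of_add_eq_zero_left h3] at h2
    simpa using h2

/-- A family indexed by `ℤ/nℤ` whose values at three distinct elements of sum zero sum to zero
is a homomorphism. -/
theorem hom_of_sum_eq_zero {n : ℕ} (hn : 10 ≤ n) {G : Type*} [AddCommGroup G] {f : ZMod n → G}
    (h0 : f 0 = 0) (h : ∀ i j k : ZMod n, i ≠ j → i ≠ k → j ≠ k → i + j + k = 0 →
      f i + f j + f k = 0) : n • f 1 = 0 ∧ ∀ k, f k = k.val • f 1 := by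
  have H : ∀ i j k : ℤ, i + j + k = 0 → i ≠ j → i ≠ k → j ≠ k → |i - j| < n → |i - k| < n →
      |j - k| < n → f i + f j + f k = 0 := by
    intro i j k hs h1 h2 h3 h4 h5 h6
    rw [abs_lt] at h4 h5 h6
    refine h _ _ _ (intCast_ne h1 ?_ ?_) (intCast_ne h2 ?_ ?_) (intCast_ne h3 ?_ ?_) ?_ <;>
      first | linarith | skip
    exact_mod_cast congrArg (Int.cast : ℤ → ZMod n) hs
  have h0' : f (0 : ℤ) = 0 := by simpa using h0
  have hneg : ∀ m : ℤ, 0 < m → 2 * m < n → f (-m : ℤ) = -f m := by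
    intro m hm hmn
    have := H 0 m (-m) (by ring) (by omega) (by omega) (by omega) (by rw [abs_lt]; omega)
      (by rw [abs_lt]; omega) (by rw [abs_lt]; omega)
    rw [h0', zero_add] at this
    exact eq_neg_of_add_eq_zero_right this
  have hdiff : ∀ i j k : ℤ, i + j + k = 0 → i ≠ j → i ≠ k → j ≠ k → |i - j| < n → |i - k| < n →
      |j - k| < n → f k = -(f i + f j) := fun i j k hs h1 h2 h3 h4 h5 h6 =>
    eq_neg_of_add_eq_zero_right (H i j k hs h1 h2 h3 h4 h5 h6)
  have hn' : (10 : ℤ) ≤ n := by exact_mod_cast hn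
  have e1 := hneg 1 (by norm_num) (by omega)
  have e2 := hneg 2 (by norm_num) (by omega)
  have e3 := hneg 3 (by norm_num) (by omega)
  have e4 := hneg 4 (by norm_num) (by omega)
  have small : ∀ x : ℤ, -9 ≤ x → x ≤ 9 → |x| < n := fun x h1 h2 => by rw [abs_lt]; omega
  have a3 := hdiff (-1) (-2) 3 (by norm_num) (by norm_num) (by norm_num) (by norm_num)
    (small _ (by norm_num) (by norm_num)) (small _ (by norm_num) (by norm_num))
    (small _ (by norm_num) (by norm_num))
  have a4 := hdiff (-1) (-3) 4 (by norm_num) (by norm_num) (by norm_num) (by norm_num)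
    (small _ (by norm_num) (by norm_num)) (small _ (by norm_num) (by norm_num))
    (small _ (by norm_num) (by norm_num))
  -- The relation f 2 = 2 f 1 would come from the triple {1, 1, -2}, which has a repeated label.
  -- Instead f (-5) is computed from 1 + 4 and from 2 + 3, giving 3 f 1 + f 2 = f 1 + 2 f 2. The
  -- labels 4 and -5 differ by 9, which is where n ≥ 10 is needed.
  have a5 := hdiff 1 4 (-5) (by norm_num) (by norm_num) (by norm_num) (by norm_num)
    (small _ (by norm_num) (by norm_num)) (small _ (by norm_num) (by norm_num))
    (small _ (by norm_num) (by norm_num))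
  have a5' := hdiff 2 3 (-5) (by norm_num) (by norm_num) (by norm_num) (by norm_num)
    (small _ (by norm_num) (by norm_num)) (small _ (by norm_num) (by norm_num))
    (small _ (by norm_num) (by norm_num))
  rw [e1, e2] at a3
  rw [e1, e3, a3] at a4
  rw [a5, a4, a3] at a5'
  have b2 : f (2 : ℤ) = 2 • f (1 : ℤ) := by
    rw [neg_inj] at a5'
    have := congrArg (fun x => x - (f (1 : ℤ) + f (2 : ℤ))) a5'
    calc f (2 : ℤ) = _ := by abel
      _ = _ := this.symm
      _ = 2 • f (1 : ℤ) := by abel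
  have key : ∀ m : ℕ, 2 * m ≤ n + 1 →
      f (m : ℤ) = m • f (1 : ℤ) ∧ f (-m : ℤ) = -(m • f (1 : ℤ)) := by
    intro m
    induction m using Nat.strong_induction_on with
    | _ m ih =>
      intro hm
      rcases Nat.lt_or_ge m 5 with h5 | h5
      · interval_cases m
        · simpa using h0
        · simpa using e1
        · exact ⟨b2, by rw [← b2]; exact e2⟩
        · have : f ((3 : ℕ) : ℤ) = 3 • f (1 : ℤ) := by
            refine a3.trans ?_
            rw [b2]; abel
          exact ⟨this, by rw [← this]; exact e3⟩
        · have : f ((4 : ℕ) : ℤ) = 4 • f (1 : ℤ) := by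
            refine a4.trans ?_
            rw [b2]; abel
          exact ⟨this, by rw [← this]; exact e4⟩
      · obtain ⟨i1, i2⟩ := ih (m - 2) (by omega) (by omega)
        obtain ⟨j1, j2⟩ := ih 2 (by omega) (by omega)
        have hc : ((m - 2 : ℕ) : ℤ) = m - 2 := by omega
        rw [hc] at i1 i2
        have hsm : m • f (1 : ℤ) = 2 • f (1 : ℤ) + (m - 2) • f (1 : ℤ) := by
          rw [← add_nsmul]; congr 1; omega
        -- The two labels 2 and m - 2 are distinct because m ≥ 5. The largest difference is 2m - 2,
        -- which is less than n exactly when 2m ≤ n + 1.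
        constructor
        · rw [hdiff (-(2 : ℕ)) (-(m - 2)) m (by push_cast; ring) (by omega) (by omega) (by omega)
            (by rw [abs_lt]; omega) (by rw [abs_lt]; omega) (by rw [abs_lt]; omega), i2, j2, hsm]
          abel
        · rw [hdiff (2 : ℕ) (m - 2) (-m) (by push_cast; ring) (by omega) (by omega) (by omega)
            (by rw [abs_lt]; omega) (by rw [abs_lt]; omega) (by rw [abs_lt]; omega), i1, j1, hsm]
  have hfin := nsmul_eq_zero_and_eq_val_nsmul (by omega) key
  simpa using hfin

/-! ### A normal form for torsion configurations -/

theorem exists_frame {a b c : Fin 3 → ℂ} (h : det3 a b c ≠ 0) :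
    ∃ g : GL (Fin 3) ℂ, g.val.mulVec a = ![1, 0, 0] ∧ g.val.mulVec b = ![0, 1, 0] ∧
      g.val.mulVec c = ![0, 0, 1] := by
  have hdet : (Matrix.of ![a, b, c]).transpose.det ≠ 0 := by
    rwa [Matrix.det_transpose, ← det3_eq_det]
  set M := Matrix.GeneralLinearGroup.mkOfDetNeZero _ hdet with hM
  have key : ∀ e v : Fin 3 → ℂ, M.val.mulVec e = v → (M⁻¹).val.mulVec v = e := by
    rintro e v rfl
    rw [Matrix.mulVec_mulVec, ← Units.val_mul, inv_mul_cancel, Units.val_one, Matrix.one_mulVec]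
  refine ⟨M⁻¹, key _ _ ?_, key _ _ ?_, key _ _ ?_⟩ <;>
  · ext i
    fin_cases i <;> simp [hM, Matrix.GeneralLinearGroup.mkOfDetNeZero, Matrix.mulVec, dotProduct,
      Fin.sum_univ_three]

/-- The coordinates of the points with labels `-4, …, 5` of a torsion configuration, after a
suitable projective transformation. -/
structure IsNormalForm {n : ℕ} (p : ZMod n → Plane) (r s : ℂ) : Prop where
  p0 : Reps (p (0 : ℤ)) ![0, 1, 0]
  p1 : Reps (p (1 : ℤ)) ![0, 0, 1]
  m1 : Reps (p (-1 : ℤ)) ![0, 1, 1]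
  p2 : Reps (p (2 : ℤ)) ![1, 1, 0]
  m2 : Reps (p (-2 : ℤ)) ![1, 0, 0]
  p3 : Reps (p (3 : ℤ)) ![1, s, s]
  m3 : Reps (p (-3 : ℤ)) ![1, 1, s]
  p4 : Reps (p (4 : ℤ)) ![1, 1 + r, s + r]
  m4 : Reps (p (-4 : ℤ)) ![1, s, s + r]
  p5 : Reps (p (5 : ℤ)) ![s - 1, r, r * s]
  s_ne_zero : s ≠ 0
  s_ne_one : s - 1 ≠ 0
  r_ne_zero : r ≠ 0
  r_ne_neg_one : 1 + r ≠ 0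
  add_ne_zero : r + s ≠ 0
  sub_ne_zero : r - s + 1 ≠ 0
  sq_ne_zero : r - s * (s - 1) ≠ 0

/-- For small integer labels, congruence modulo n ≥ 10 is equality. The side conditions do not
mention n, so `decide` settles them for numerals. -/
theorem IsTorsionConfig.det3_intCast {n : ℕ} (hn : 10 ≤ n) {p : ZMod n → Plane}
    (hp : IsTorsionConfig p) {i j k : ℤ} {u v w : Fin 3 → ℂ}
    (hu : Reps (p i) u) (hv : Reps (p j) v) (hw : Reps (p k) w)
    (h : (i ≠ j ∧ i ≠ k ∧ j ≠ k) ∧ (|i - j| ≤ 9 ∧ |i - k| ≤ 9 ∧ |j - k| ≤ 9) ∧ |i + j + k| ≤ 9) :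
    det3 u v w = 0 ↔ i + j + k = 0 := by
  obtain ⟨⟨h1, h2, h3⟩, ⟨h4, h5, h6⟩, h7⟩ := h
  have hn' : (10 : ℤ) ≤ n := by exact_mod_cast hn
  rw [abs_le] at h4 h5 h6 h7
  rw [hp.det3_eq_zero_iff (intCast_ne h1 (by omega) (by omega))
    (intCast_ne h2 (by omega) (by omega)) (intCast_ne h3 (by omega) (by omega)) hu hv hw]
  constructor
  · intro h
    by_contra hne
    refine intCast_ne (n := n) hne (by omega) (by omega) ?_
    push_cast
    exact h
  · intro h
    exact_mod_cast congrArg (Int.cast : ℤ → ZMod n) h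

theorem Reps.normalize {x : Plane} {v w : Fin 3 → ℂ} (h : Reps x v) (c : ℂ) (hc : c ≠ 0)
    (h0 : w 0 = c * v 0) (h1 : w 1 = c * v 1) (h2 : w 2 = c * v 2) : Reps x w := by
  refine h.of_smul c hc ?_
  ext i
  fin_cases i
  · exact h0
  · exact h1
  · exact h2

/-- The labels -2, 0, 1 have nonzero sum, so their points can be moved to the coordinate points. The
diagonal matrices that remain normalize `p (-1)` on the line of 0, 1 and `p 2` on the line of 0, -2.
-/
theorem IsTorsionConfig.exists_partial_normalForm {n : ℕ} (hn : 10 ≤ n) {p : ZMod n → Plane}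
    (hp : IsTorsionConfig p) : ∃ (g : GL (Fin 3) ℂ) (q : ZMod n → Plane),
      (∀ k, (Matrix.ProjGenLinGroup.mk g : PGL(3, ℂ)) • p k = q k) ∧
      Reps (q (0 : ℤ)) ![0, 1, 0] ∧ Reps (q (1 : ℤ)) ![0, 0, 1] ∧ Reps (q (-1 : ℤ)) ![0, 1, 1] ∧
      Reps (q (2 : ℤ)) ![1, 1, 0] ∧ Reps (q (-2 : ℤ)) ![1, 0, 0] := by
  have hdet : det3 (p (-2 : ℤ)).rep (p (0 : ℤ)).rep (p (1 : ℤ)).rep ≠ 0 := by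
    rw [ne_eq, hp.det3_intCast hn (reps_rep _) (reps_rep _) (reps_rep _) (by decide)]
    decide
  obtain ⟨g, g2, g0, g1⟩ := exists_frame hdet
  set q : ZMod n → Plane := fun k => (Matrix.ProjGenLinGroup.mk g : PGL(3, ℂ)) • p k with hqdef
  have hq : IsTorsionConfig q := hp.mk_smul g (fun _ => rfl)
  have r2 : Reps (q (-2 : ℤ)) ![1, 0, 0] := g2 ▸ (reps_rep (p (-2 : ℤ))).mk_smul g
  have r0 : Reps (q (0 : ℤ)) ![0, 1, 0] := g0 ▸ (reps_rep (p (0 : ℤ))).mk_smul g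
  have r1 : Reps (q (1 : ℤ)) ![0, 0, 1] := g1 ▸ (reps_rep (p (1 : ℤ))).mk_smul g
  have hm := reps_rep (q (-1 : ℤ))
  have h2 := reps_rep (q (2 : ℤ))
  set m := (q (-1 : ℤ)).rep
  set t := (q (2 : ℤ)).rep
  have m0 : m 0 = 0 := by
    have := (hq.det3_intCast hn r0 r1 hm (by decide)).mpr (by decide)
    simpa [det3] using this
  have m2 : m 2 ≠ 0 := by
    have := (hq.det3_intCast hn r0 r2 hm (by decide)).not.mpr (by decide)
    simpa [det3] using this
  have m1 : m 1 ≠ 0 := by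
    have := (hq.det3_intCast hn r1 r2 hm (by decide)).not.mpr (by decide)
    simpa [det3] using this
  have t2 : t 2 = 0 := by
    have := (hq.det3_intCast hn r0 r2 h2 (by decide)).mpr (by decide)
    simpa [det3] using this
  have t1 : t 1 ≠ 0 := by
    have := (hq.det3_intCast hn r1 r2 h2 (by decide)).not.mpr (by decide)
    simpa [det3] using this
  have t0 : t 0 ≠ 0 := by
    have := (hq.det3_intCast hn r0 r1 h2 (by decide)).not.mpr (by decide)
    simpa [det3] using this
  set D : GL (Fin 3) ℂ := Matrix.GeneralLinearGroup.mkOfDetNeZero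
    !![t 1 / t 0, 0, 0; 0, 1, 0; 0, 0, m 1 / m 2]
    (by simp [Matrix.det_fin_three, m1, m2, t1, t0]) with hD
  have hDv : ∀ v : Fin 3 → ℂ, D.val.mulVec v = ![t 1 / t 0 * v 0, v 1, m 1 / m 2 * v 2] := by
    intro v
    ext i
    fin_cases i <;> simp [hD, Matrix.GeneralLinearGroup.mkOfDetNeZero, Matrix.mulVec, dotProduct,
      Fin.sum_univ_three]
  have hDr : ∀ {x : Plane} {v : Fin 3 → ℂ}, Reps x v →
      Reps ((Matrix.ProjGenLinGroup.mk D : PGL(3, ℂ)) • x)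
        ![t 1 / t 0 * v 0, v 1, m 1 / m 2 * v 2] := fun {x v} h => hDv v ▸ h.mk_smul D
  refine ⟨D * g, fun k => (Matrix.ProjGenLinGroup.mk D : PGL(3, ℂ)) • q k, fun k => ?_,
    ?_, ?_, ?_, ?_, ?_⟩
  · rw [map_mul, mul_smul]
  · exact (hDr r0).normalize 1 one_ne_zero (by simp) (by simp) (by simp)
  · exact (hDr r1).normalize (m 2 / m 1) (div_ne_zero m2 m1) (by simp) (by simp)
      (by simp; field_simp)
  · refine (hDr hm).normalize (1 / m 1) (one_div_ne_zero m1) (by simp [m0]) (by simp [m1]) ?_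
    simp; field_simp
  · refine (hDr h2).normalize (1 / t 1) (one_div_ne_zero t1) ?_ (by simp [t1]) (by simp [t2])
    simp; field_simp
  · refine (hDr r2).normalize (t 0 / t 1) (div_ne_zero t0 t1) ?_ (by simp) (by simp)
    simp; field_simp

/-- Each of the labels -3, -4, 5 is the intersection of two known lines: (1, 2) and (0, 3); (1, 3)
and (0, 4); (-2, -3) and (-1, -4). For 3 and 4 only one known line is used, (-1, -2) and (-1, -3),
and the position on it is the parameter `s` or `r`. The inequalities record triples of nonzero sum.
-/
theorem IsTorsionConfig.exists_normalForm {n : ℕ} (hn : 10 ≤ n) {p : ZMod n → Plane}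
    (hp : IsTorsionConfig p) : ∃ (g : GL (Fin 3) ℂ) (q : ZMod n → Plane) (r s : ℂ),
      (∀ k, (Matrix.ProjGenLinGroup.mk g : PGL(3, ℂ)) • p k = q k) ∧ IsNormalForm q r s := by
  obtain ⟨g, q, hgq, r0, r1, rm1, r2, rm2⟩ := hp.exists_partial_normalForm hn
  have hq := hp.mk_smul g hgq
  obtain ⟨s, r3⟩ : ∃ s, Reps (q (3 : ℤ)) ![1, s, s] := by
    have h := reps_rep (q (3 : ℤ))
    set v := (q (3 : ℤ)).rep
    have h1 := (hq.det3_intCast hn rm1 rm2 h (by decide)).mpr (by decide)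
    have h2 := (hq.det3_intCast hn r0 r1 h (by decide)).not.mpr (by decide)
    simp [det3] at h1 h2
    refine ⟨v 1 / v 0, h.normalize (1 / v 0) (one_div_ne_zero h2) ?_ ?_ ?_⟩
    · simp; field_simp
    · simp; field_simp
    · simp; field_simp; linear_combination h1
  have rm3 : Reps (q (-3 : ℤ)) ![1, 1, s] := by
    have h := reps_rep (q (-3 : ℤ))
    set v := (q (-3 : ℤ)).rep
    have h1 := (hq.det3_intCast hn r1 r2 h (by decide)).mpr (by decide)
    have h2 := (hq.det3_intCast hn r0 r1 h (by decide)).not.mpr (by decide)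
    have h3 := (hq.det3_intCast hn r0 r3 h (by decide)).mpr (by decide)
    simp [det3] at h1 h2 h3
    refine h.normalize (1 / v 0) (one_div_ne_zero h2) ?_ ?_ ?_
    · simp; field_simp
    · simp; field_simp; linear_combination -h1
    · simp; field_simp; linear_combination h3
  obtain ⟨r, r4⟩ : ∃ r, Reps (q (4 : ℤ)) ![1, 1 + r, s + r] := by
    have h := reps_rep (q (4 : ℤ))
    set v := (q (4 : ℤ)).rep
    have h1 := (hq.det3_intCast hn rm1 rm3 h (by decide)).mpr (by decide)
    have h2 := (hq.det3_intCast hn r0 r1 h (by decide)).not.mpr (by decide)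
    simp [det3] at h1 h2
    refine ⟨v 1 / v 0 - 1, h.normalize (1 / v 0) (one_div_ne_zero h2) ?_ ?_ ?_⟩
    · simp; field_simp
    · simp; field_simp
    · simp; field_simp; linear_combination h1
  have rm4 : Reps (q (-4 : ℤ)) ![1, s, s + r] := by
    have h := reps_rep (q (-4 : ℤ))
    set v := (q (-4 : ℤ)).rep
    have h1 := (hq.det3_intCast hn r1 r3 h (by decide)).mpr (by decide)
    have h2 := (hq.det3_intCast hn r0 r1 h (by decide)).not.mpr (by decide)
    have h3 := (hq.det3_intCast hn r0 r4 h (by decide)).mpr (by decide)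
    simp [det3] at h1 h2 h3
    refine h.normalize (1 / v 0) (one_div_ne_zero h2) ?_ ?_ ?_
    · simp; field_simp
    · simp; field_simp; linear_combination -h1
    · simp; field_simp; linear_combination h3
  have s1 : s - 1 ≠ 0 := by
    have := (hq.det3_intCast hn r1 r2 r3 (by decide)).not.mpr (by decide)
    simpa [det3] using this
  have r5 : Reps (q (5 : ℤ)) ![s - 1, r, r * s] := by
    have h := reps_rep (q (5 : ℤ))
    set v := (q (5 : ℤ)).rep
    have h1 := (hq.det3_intCast hn rm2 rm3 h (by decide)).mpr (by decide)
    have h2 := (hq.det3_intCast hn r0 r1 h (by decide)).not.mpr (by decide)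
    have h3 := (hq.det3_intCast hn rm1 rm4 h (by decide)).mpr (by decide)
    simp [det3] at h1 h2 h3
    refine h.normalize ((s - 1) / v 0) (div_ne_zero s1 h2) ?_ ?_ ?_
    · simp; field_simp
    · simp; field_simp; linear_combination h3 + h1
    · simp; field_simp; linear_combination s * h3 + h1
  refine ⟨g, q, r, s, hgq, r0, r1, rm1, r2, rm2, r3, rm3, r4, rm4, r5, ?_, s1, ?_, ?_, ?_, ?_, ?_⟩
  · have := (hq.det3_intCast hn r1 rm2 r3 (by decide)).not.mpr (by decide)
    simpa [det3] using this
  · have := (hq.det3_intCast hn r1 r2 r4 (by decide)).not.mpr (by decide)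
    simpa [det3] using this
  · have := (hq.det3_intCast hn r1 rm2 r4 (by decide)).not.mpr (by decide)
    simpa [det3] using this
  · have := (hq.det3_intCast hn r0 rm2 r4 (by decide)).not.mpr (by decide)
    simp [det3] at this
    exact fun h => this (by linear_combination -h)
  · have := (hq.det3_intCast hn r1 r2 r5 (by decide)).not.mpr (by decide)
    simp [det3] at this
    intro h
    exact this (by linear_combination h)
  · have := (hq.det3_intCast hn r1 rm4 r5 (by decide)).not.mpr (by decide)
    simpa [det3] using this

/-! ### The Tate normal form -/

theorem exists_eq_some {W : WeierstrassCurve ℂ} {Q : W.toAffine.Point} {X Y x y : ℂ}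
    {h : W.toAffine.Nonsingular X Y} (hQ : Q = .some X Y h) (hx : X = x) (hy : Y = y) :
    ∃ h, Q = .some x y h := by
  subst hx hy
  exact ⟨h, hQ⟩

/-- The Tate normal form of a Weierstrass curve with a marked point `(0, 0)`. -/
def tateCurve (b c : ℂ) : WeierstrassCurve ℂ := ⟨1 - c, -b, -b, 0, 0⟩

/-- Writing d = b / c makes the coordinates of all these multiples polynomial in c and d. -/
theorem tateCurve_multiples {b c d : ℂ} (hb : b = c * d) (hc : c ≠ 0) (hd : d ≠ 0) :
    ∃ P : (tateCurve b c).toAffine.Point,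
      (∃ h, P = .some 0 0 h) ∧ (∃ h, -P = .some 0 b h) ∧
      (∃ h, 2 • P = .some b (b * c) h) ∧ (∃ h, -(2 • P) = .some b 0 h) ∧
      (∃ h, 3 • P = .some c (b - c) h) ∧ (∃ h, -(3 • P) = .some c (c ^ 2) h) ∧
      (∃ h, 4 • P = .some (d * (d - 1)) (d ^ 2 * (c - d + 1)) h) ∧
      (∃ h, -(4 • P) = .some (d * (d - 1)) (d * (d - 1) ^ 2) h) := by
  have hb0 : b ≠ 0 := hb ▸ mul_ne_zero hc hd
  have hns : (tateCurve b c).toAffine.Nonsingular 0 0 := by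
    rw [WeierstrassCurve.Affine.nonsingular_iff', WeierstrassCurve.Affine.equation_iff']
    simp [tateCurve, hb0]
  have neg : ∀ {Q : (tateCurve b c).toAffine.Point} {x y : ℂ}, (∃ h, Q = .some x y h) →
      ∀ y', -y - (1 - c) * x + b = y' → ∃ h, -Q = .some x y' h := by
    rintro Q x y ⟨h, rfl⟩ y' hy
    refine exists_eq_some (WeierstrassCurve.Affine.Point.neg_some h) rfl ?_
    simp [tateCurve, WeierstrassCurve.Affine.negY]
    linear_combination hy
  -- adding the point `(0, 0)`
  have add : ∀ {Q : (tateCurve b c).toAffine.Point} {x y : ℂ}, x ≠ 0 → (∃ h, Q = .some x y h) →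
      ∀ x' y', (y / x) ^ 2 + (1 - c) * (y / x) + b - x = x' →
        -(y / x * x') - (1 - c) * x' + b = y' → ∃ h, Q + .some 0 0 hns = .some x' y' h := by
    rintro Q x y hx ⟨h, rfl⟩ x' y' hx' hy'
    have hX : (tateCurve b c).toAffine.addX x 0 ((tateCurve b c).toAffine.slope x 0 y 0) = x' := by
      rw [WeierstrassCurve.Affine.slope_of_X_ne hx]
      simp [tateCurve]
      linear_combination hx'
    refine exists_eq_some (WeierstrassCurve.Affine.Point.add_some (fun h => hx h.1)) hX ?_
    rw [WeierstrassCurve.Affine.addY, WeierstrassCurve.Affine.negAddY, hX,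
      WeierstrassCurve.Affine.slope_of_X_ne hx]
    simp [tateCurve, WeierstrassCurve.Affine.negY]
    field_simp at hy' ⊢
    linear_combination hy'
  set P : (tateCurve b c).toAffine.Point := .some 0 0 hns with hP
  have h1 : ∃ h, P = .some 0 0 h := ⟨hns, rfl⟩
  have h2 : ∃ h, 2 • P = .some b (b * c) h := by
    have hY : (0 : ℂ) ≠ (tateCurve b c).toAffine.negY 0 0 := by
      simpa [tateCurve, WeierstrassCurve.Affine.negY] using hb0.symm
    -- The tangent at (0, 0) is the line y = 0, since a₄ = 0.
    have hs : (tateCurve b c).toAffine.slope 0 0 0 0 = 0 := by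
      rw [WeierstrassCurve.Affine.slope_of_Y_ne rfl hY]
      simp [tateCurve]
    rw [two_nsmul]
    refine exists_eq_some (WeierstrassCurve.Affine.Point.add_self_of_Y_ne hY) ?_ ?_
    · rw [hs]; simp [tateCurve]
    · rw [hs]; simp [tateCurve, WeierstrassCurve.Affine.addY, WeierstrassCurve.Affine.negY]; ring
  have h3 : ∃ h, 3 • P = .some c (b - c) h := by
    rw [show (3 : ℕ) = 2 + 1 from rfl, add_nsmul, one_nsmul]
    refine add hb0 h2 _ _ ?_ ?_
    · field_simp; ring
    · field_simp; ring
  have h4 : ∃ h, 4 • P = .some (d * (d - 1)) (d ^ 2 * (c - d + 1)) h := by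
    rw [show (4 : ℕ) = 3 + 1 from rfl, add_nsmul, one_nsmul]
    refine add hc h3 _ _ ?_ ?_
    · subst hb; field_simp; ring
    · subst hb; field_simp; ring
  refine ⟨P, h1, neg h1 _ (by ring), h2, neg h2 _ (by ring), h3, neg h3 _ (by ring), h4,
    neg h4 _ (by rw [hb]; ring)⟩

/-- The curve is found by matching parameters. No nonvanishing of its discriminant is claimed: the
singular cubics occur here too. -/
theorem IsNormalForm.exists_weierstrass {n : ℕ} {p : ZMod n → Plane} {r s : ℂ}
    (h : IsNormalForm p r s) : ∃ (g : GL (Fin 3) ℂ) (W : WeierstrassCurve ℂ)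
      (P : W.toAffine.Point), ∀ m : ℕ, m ≤ 4 →
        (Matrix.ProjGenLinGroup.mk g : PGL(3, ℂ)) • p (m : ℤ) = toPlane (m • P) ∧
        (Matrix.ProjGenLinGroup.mk g : PGL(3, ℂ)) • p (-m : ℤ) = toPlane (-(m • P)) := by
  have hs := h.s_ne_zero
  have hrs := h.add_ne_zero
  have hs1 : 1 - s ≠ 0 := fun h' => h.s_ne_one (by linear_combination -h')
  -- With b = c * d, the matrix `g` below matches the labels 0, ±1, ±2 for all nonzero c, d. The
  -- labels ±3 force d = 1 + c * s, and ±4 then force (d - 1) * (r + s) = 1 - s; these two equations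
  -- determine d and c.
  obtain ⟨d, hd⟩ : ∃ d, d = (1 + r) / (r + s) := ⟨_, rfl⟩
  have hd0 : d ≠ 0 := hd ▸ div_ne_zero h.r_ne_neg_one hrs
  have hd' : (d - 1) * (r + s) = 1 - s := by rw [hd]; field_simp; ring
  have hdr : d * (r + s) = 1 + r := by linear_combination hd'
  have hd1 : d - 1 ≠ 0 := fun h' => hs1 (by rw [← hd', h', zero_mul])
  obtain ⟨c, hc⟩ : ∃ c, c = (d - 1) / s := ⟨_, rfl⟩
  have hc0 : c ≠ 0 := hc ▸ div_ne_zero hd1 hs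
  have hcs : d - 1 = c * s := by rw [hc]; field_simp
  have hcr : c * (r + s) * s = 1 - s := by rw [← hd', hcs]; ring
  obtain ⟨P, ⟨_, e1⟩, ⟨_, f1⟩, ⟨_, e2⟩, ⟨_, f2⟩, ⟨_, e3⟩, ⟨_, f3⟩, ⟨_, e4⟩, ⟨_, f4⟩⟩ :=
    tateCurve_multiples (b := c * d) rfl hc0 hd0
  set g : GL (Fin 3) ℂ := Matrix.GeneralLinearGroup.mkOfDetNeZero
    !![d, 0, 0; 0, c * d, 0; 1 / c, 0, 1]
    (by simp [Matrix.det_fin_three, hd0, hc0]) with hg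
  have hgv : ∀ v : Fin 3 → ℂ, g.val.mulVec v = ![d * v 0, c * d * v 1, 1 / c * v 0 + v 2] := by
    intro v
    ext i
    fin_cases i <;> simp [hg, Matrix.GeneralLinearGroup.mkOfDetNeZero, Matrix.mulVec, dotProduct,
      Fin.sum_univ_three]
  have key : ∀ {x : Plane} {v w : Fin 3 → ℂ} {Q : (tateCurve (c * d) c).toAffine.Point} (a : ℂ),
      Reps x v → coords Q = w → a ≠ 0 → w 0 = a * (d * v 0) → w 1 = a * (c * d * v 1) →
      w 2 = a * (1 / c * v 0 + v 2) →
      (Matrix.ProjGenLinGroup.mk g : PGL(3, ℂ)) • x = toPlane Q := by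
    rintro x v w Q a hx rfl ha h0 h1 h2
    have := hx.mk_smul g
    rw [hgv] at this
    exact (this.normalize a ha h0 h1 h2).eq (reps_toPlane Q)
  have hd2 : d = 1 + c * s := by linear_combination hcs
  refine ⟨g, _, P, fun m hm => ?_⟩
  interval_cases m
  · simp only [zero_nsmul, neg_zero, Nat.cast_zero, and_self]
    refine key (w := ![0, 1, 0]) (1 / (c * d)) h.p0 rfl (one_div_ne_zero (mul_ne_zero hc0 hd0)) ?_ ?_ ?_ <;> simp
    field_simp
  · rw [one_nsmul]
    refine ⟨key (w := ![0, 0, 1]) 1 h.p1 (by rw [e1]; rfl) one_ne_zero ?_ ?_ ?_,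
      key (w := ![0, c * d, 1]) 1 h.m1 (by rw [f1]; rfl) one_ne_zero ?_ ?_ ?_⟩ <;> simp
  · refine ⟨key (w := ![c * d, c * d * c, 1]) c h.p2 (by rw [e2]; rfl) hc0 ?_ ?_ ?_,
      key (w := ![c * d, 0, 1]) c h.m2 (by rw [f2]; rfl) hc0 ?_ ?_ ?_⟩ <;> simp [hc0]
    ring
  · refine ⟨key (w := ![c, c * d - c, 1]) (c / d) h.p3 (by rw [e3]; rfl) (div_ne_zero hc0 hd0) ?_ ?_ ?_,
      key (w := ![c, c ^ 2, 1]) (c / d) h.m3 (by rw [f3]; rfl) (div_ne_zero hc0 hd0) ?_ ?_ ?_⟩ <;>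
      simp <;> field_simp <;> linear_combination hd2
  · refine ⟨key (w := ![d * (d - 1), d ^ 2 * (c - d + 1), 1]) (d - 1) h.p4 (by rw [e4]; rfl) hd1
        ?_ ?_ ?_,
      key (w := ![d * (d - 1), d * (d - 1) ^ 2, 1]) (d - 1) h.m4 (by rw [f4]; rfl) hd1 ?_ ?_ ?_⟩ <;>
      simp
    · ring
    · linear_combination (d - 1) * c * d * hdr - c * d ^ 2 * hd' - d ^ 2 * hcs
    · field_simp
      linear_combination -c * hd' - hcs
    · ring
    · linear_combination d * (d - 1) * hcs
    · field_simp
      linear_combination -c * hd' - hcs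

/-! ### Every torsion configuration lies on a Weierstrass cubic -/

theorem IsTorsionConfig.det3_ne_zero {n : ℕ} {p : ZMod n → Plane} (hp : IsTorsionConfig p)
    {i j k : ℤ} (h : (i ≠ j ∧ i ≠ k ∧ j ≠ k) ∧ (|i - j| < n ∧ |i - k| < n ∧ |j - k| < n) ∧
      i + j + k ≠ 0 ∧ |i + j + k| < n) : det3 (p i).rep (p j).rep (p k).rep ≠ 0 := by
  obtain ⟨⟨h1, h2, h3⟩, ⟨h4, h5, h6⟩, h0, h7⟩ := h
  rw [abs_lt] at h4 h5 h6 h7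
  rw [ne_eq, hp _ _ _ (intCast_ne h1 (by omega) (by omega))
    (intCast_ne h2 (by omega) (by omega)) (intCast_ne h3 (by omega) (by omega))]
  have := intCast_ne (n := n) h0 (by omega) (by omega)
  exact_mod_cast this

theorem IsTorsionConfig.det3_eq_zero {n : ℕ} {p : ZMod n → Plane} (hp : IsTorsionConfig p)
    {i j k : ℤ} (h : (i ≠ j ∧ i ≠ k ∧ j ≠ k) ∧ (|i - j| < n ∧ |i - k| < n ∧ |j - k| < n) ∧
      i + j + k = 0) : det3 (p i).rep (p j).rep (p k).rep = 0 := by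
  obtain ⟨⟨h1, h2, h3⟩, ⟨h4, h5, h6⟩, h0⟩ := h
  rw [abs_lt] at h4 h5 h6
  rw [hp _ _ _ (intCast_ne h1 (by omega) (by omega))
    (intCast_ne h2 (by omega) (by omega)) (intCast_ne h3 (by omega) (by omega))]
  exact_mod_cast congrArg (Int.cast : ℤ → ZMod n) h0

/-- The point `p m` and the multiple m • P both lie on the line through `p a`, `p b` and on the line
through `p c`, `p d`. The conditions on a + b + c and c + d + a make these lines distinct. -/
theorem IsTorsionConfig.eq_multiple {n : ℕ} {p : ZMod n → Plane} (hp : IsTorsionConfig p)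
    {W : WeierstrassCurve ℂ} {P : W.toAffine.Point} {a b c d m : ℤ}
    (ha : p a = toPlane (a • P)) (hb : p b = toPlane (b • P)) (hc : p c = toPlane (c • P))
    (hd : p d = toPlane (d • P)) (hab : a + b + m = 0) (hcd : c + d + m = 0)
    (h : (a ≠ b ∧ a ≠ c ∧ b ≠ c ∧ c ≠ d ∧ a ≠ d ∧ a ≠ m ∧ b ≠ m ∧ c ≠ m ∧ d ≠ m) ∧
      (|a - b| < n ∧ |a - c| < n ∧ |b - c| < n ∧ |c - d| < n ∧ |a - d| < n ∧ |a - m| < n ∧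
        |b - m| < n ∧ |c - m| < n ∧ |d - m| < n) ∧
      a + b + c ≠ 0 ∧ |a + b + c| < n ∧ c + d + a ≠ 0 ∧ |c + d + a| < n) :
    p m = toPlane (m • P) := by
  obtain ⟨⟨h1, h2, h3, h4, h5, h6, h7, h8, h9⟩, ⟨k1, k2, k3, k4, k5, k6, k7, k8, k9⟩,
    l1, l2, l3, l4⟩ := h
  have conv : ∀ {x y : ℤ}, p x = toPlane (x • P) → p y = toPlane (y • P) →
      x + y + m = 0 → det3 (p x).rep (p y).rep (coords (m • P)) = 0 := by
    intro x y hx hy hs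
    refine ((reps_rep (p x)).det3_eq_zero_iff (reps_rep (p y)) (reps_toPlane (m • P))
      (hx ▸ reps_toPlane _) (hy ▸ reps_toPlane _) (reps_toPlane _)).mpr ?_
    exact det3_coords_of_add_eq_zero (by rw [← add_zsmul, ← add_zsmul, hs, zero_zsmul])
  refine ((reps_rep (p m)).eq_of_det3 (reps_toPlane (m • P)).ne_zero
    (hp.det3_ne_zero (i := a) (j := b) (k := c) ⟨⟨h1, h2, h3⟩, ⟨k1, k2, k3⟩, l1, l2⟩)
    (hp.det3_ne_zero (i := c) (j := d) (k := a)
      ⟨⟨h4, h2.symm, h5.symm⟩, ⟨k4, by rwa [abs_sub_comm], by rwa [abs_sub_comm]⟩, l3, l4⟩)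
    (hp.det3_eq_zero ⟨⟨h1, h6, h7⟩, ⟨k1, k6, k7⟩, hab⟩)
    (hp.det3_eq_zero ⟨⟨h4, h8, h9⟩, ⟨k4, k8, k9⟩, hcd⟩)
    (conv ha hb hab) (conv hc hd hcd)).eq (reps_toPlane _)

theorem IsTorsionConfig.eq_multiples {n : ℕ} (hn : 10 ≤ n) {p : ZMod n → Plane}
    (hp : IsTorsionConfig p) {W : WeierstrassCurve ℂ} {P : W.toAffine.Point}
    (h : ∀ m : ℕ, m ≤ 4 → p (m : ℤ) = toPlane (m • P) ∧ p (-m : ℤ) = toPlane (-(m • P))) :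
    ∀ m : ℕ, 2 * m ≤ n →
      p (m : ℤ) = toPlane (m • P) ∧ p (-m : ℤ) = toPlane (-(m • P)) := by
  have h' : ∀ m : ℤ, |m| ≤ 4 → p m = toPlane (m • P) := by
    intro m hm
    obtain ⟨m, rfl | rfl⟩ := m.eq_nat_or_neg
    · rw [natCast_zsmul]
      exact (h m (by rw [abs_le] at hm; omega)).1
    · rw [neg_zsmul, natCast_zsmul]
      exact (h m (by rw [abs_le] at hm; omega)).2
  have main : ∀ m : ℕ, 2 * m ≤ n →
      p (m : ℤ) = toPlane ((m : ℤ) • P) ∧ p (-m : ℤ) = toPlane ((-m : ℤ) • P) := by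
    intro m
    induction m using Nat.strong_induction_on with
    | _ m ih =>
      intro hm
      rcases Nat.lt_or_ge m 5 with h5 | h5
      · exact ⟨h' _ (by rw [abs_le]; omega), h' _ (by rw [abs_le]; omega)⟩
      obtain ⟨i1, i2⟩ := ih (m - 2) (by omega) (by omega)
      obtain ⟨j1, j2⟩ := ih (m - 1) (by omega) (by omega)
      rw [show ((m - 2 : ℕ) : ℤ) = m - 2 by omega] at i1 i2
      rw [show ((m - 1 : ℕ) : ℤ) = m - 1 by omega] at j1 j2
      constructor
      -- The two lines join the labels -2, -(m - 2) and -1, -(m - 1). The largest difference of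
      -- labels is m + (m - 1), less than n because 2m ≤ n.
      · refine hp.eq_multiple (h' (-2) (by decide)) i2 (h' (-1) (by decide)) j2 (by ring)
          (by ring) ?_
        simp only [abs_lt]
        omega
      · refine hp.eq_multiple (h' 2 (by decide)) i1 (h' 1 (by decide)) j1 (by ring)
          (by ring) ?_
        simp only [abs_lt]
        omega
  intro m hm
  have := main m hm
  rwa [neg_zsmul, natCast_zsmul] at this

/-- Once all points are known to lie on the cubic, the chord law makes the labeling a homomorphism,
and its injectivity gives the exact order. -/
theorem IsTorsionConfig.exists_weierstrass {n : ℕ} (hn : 10 ≤ n) {p : ZMod n → Plane}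
    (hp : IsTorsionConfig p) : ∃ (g : GL (Fin 3) ℂ) (W : WeierstrassCurve ℂ)
      (P : W.toAffine.Point), addOrderOf P = n ∧
        ∀ k : ZMod n, (Matrix.ProjGenLinGroup.mk g : PGL(3, ℂ)) • p k = toPlane (k.val • P) := by
  have : NeZero n := ⟨by omega⟩
  obtain ⟨g, q, r, s, hgq, hq⟩ := hp.exists_normalForm hn
  obtain ⟨g', W, P, hP⟩ := hq.exists_weierstrass
  set q' : ZMod n → Plane := fun k => (Matrix.ProjGenLinGroup.mk g' : PGL(3, ℂ)) • q k with hq'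
  have hgq' : ∀ k, (Matrix.ProjGenLinGroup.mk (g' * g) : PGL(3, ℂ)) • p k = q' k := by
    intro k
    rw [map_mul, mul_smul, hgq]
  have hc : IsTorsionConfig q' := hp.mk_smul _ hgq'
  have hmul := hc.eq_multiples hn hP
  -- Every residue is represented by some ±m with 2m ≤ n.
  have hex : ∀ k, ∃ Q : W.toAffine.Point, q' k = toPlane Q := by
    intro k
    have hk : ((k.val : ℕ) : ZMod n) = k := ZMod.natCast_zmod_val k
    have hlt := k.val_lt
    by_cases hle : 2 * k.val ≤ n
    · have h1 := (hmul _ hle).1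
      rw [Int.cast_natCast, hk] at h1
      exact ⟨_, h1⟩
    · have h2 := (hmul (n - k.val) (by omega)).2
      rw [show ((n - k.val : ℕ) : ℤ) = n - k.val by omega] at h2
      push_cast at h2
      rw [hk] at h2
      refine ⟨-((n - k.val) • P), ?_⟩
      simpa using h2
  choose f hf using hex
  have hfne : ∀ {i j}, i ≠ j → f i ≠ f j := fun {i j} hij h =>
    hij (hc.injective hn (by rw [hf, hf, h]))
  have f0 : f 0 = 0 := by
    have := (hmul 0 (by omega)).1
    simp only [Nat.cast_zero, Int.cast_zero, zero_nsmul] at this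
    exact toPlane_injective ((hf 0).symm.trans this)
  have f1 : f 1 = P := by
    have := (hmul 1 (by omega)).1
    simp only [Nat.cast_one, Int.cast_one, one_nsmul] at this
    exact toPlane_injective ((hf 1).symm.trans this)
  obtain ⟨hn0, hall⟩ := hom_of_sum_eq_zero hn f0 (fun i j k hij hik hjk hs =>
    add_eq_zero_of_det3_coords (hfne hij) (hfne hik) (hfne hjk)
      ((hc.det3_eq_zero_iff hij hik hjk (hf i ▸ reps_toPlane _) (hf j ▸ reps_toPlane _)
        (hf k ▸ reps_toPlane _)).mpr hs))
  rw [f1] at hn0 hall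
  refine ⟨g' * g, W, P, ?_, fun k => by rw [hgq', hf, hall]⟩
  rw [addOrderOf_eq_iff (by omega)]
  refine ⟨hn0, fun m hm hm0 h => ?_⟩
  have h1 := hall m
  rw [ZMod.val_natCast_of_lt hm, h, ← f0] at h1
  have h3 : (m : ZMod n) = 0 := by
    by_contra hne
    exact hfne hne h1
  rw [ZMod.natCast_eq_zero_iff] at h3
  exact absurd (Nat.le_of_dvd hm0 h3) (by omega)

/-! ### Cubic forms -/

open MvPolynomial

/-- A form of degree 3 in three variables, as a function, is a combination of the ten cubic
monomials. -/
theorem exists_eval_eq_of_isHomogeneous {F : MvPolynomial (Fin 3) ℂ} (hF : F.IsHomogeneous 3) :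
    ∃ a : Fin 10 → ℂ, ∀ v : Fin 3 → ℂ, eval v F =
      a 0 * v 0 ^ 3 + a 1 * v 1 ^ 3 + a 2 * v 2 ^ 3 + a 3 * (v 0 ^ 2 * v 1) +
      a 4 * (v 0 ^ 2 * v 2) + a 5 * (v 0 * v 1 ^ 2) + a 6 * (v 0 * v 1 * v 2) +
      a 7 * (v 0 * v 2 ^ 2) + a 8 * (v 1 ^ 2 * v 2) + a 9 * (v 1 * v 2 ^ 2) := by
  have key : ∀ s : Finset (Fin 3 →₀ ℕ), (∀ d ∈ s, d 0 + d 1 + d 2 = 3) →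
      ∃ a : Fin 10 → ℂ, ∀ v : Fin 3 → ℂ,
      ∑ d ∈ s, coeff d F * (v 0 ^ d 0 * v 1 ^ d 1 * v 2 ^ d 2) =
      a 0 * v 0 ^ 3 + a 1 * v 1 ^ 3 + a 2 * v 2 ^ 3 + a 3 * (v 0 ^ 2 * v 1) +
      a 4 * (v 0 ^ 2 * v 2) + a 5 * (v 0 * v 1 ^ 2) + a 6 * (v 0 * v 1 * v 2) +
      a 7 * (v 0 * v 2 ^ 2) + a 8 * (v 1 ^ 2 * v 2) + a 9 * (v 1 * v 2 ^ 2) := by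
    intro s
    induction s using Finset.induction_on with
    | empty => exact fun _ => ⟨0, fun v => by simp⟩
    | insert d s hd ih =>
      intro h
      obtain ⟨a, ha⟩ := ih (fun e he => h e (Finset.mem_insert_of_mem he))
      have hd3 := h d (Finset.mem_insert_self d s)
      have hmon : ∃ i : Fin 10, ∀ v : Fin 3 → ℂ, v 0 ^ d 0 * v 1 ^ d 1 * v 2 ^ d 2 =
          ![v 0 ^ 3, v 1 ^ 3, v 2 ^ 3, v 0 ^ 2 * v 1, v 0 ^ 2 * v 2, v 0 * v 1 ^ 2,
            v 0 * v 1 * v 2, v 0 * v 2 ^ 2, v 1 ^ 2 * v 2, v 1 * v 2 ^ 2] i := by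
        generalize d 0 = x at hd3
        generalize d 1 = y at hd3
        obtain ⟨z, hz⟩ : ∃ z, z = d 2 := ⟨_, rfl⟩
        rw [← hz] at hd3 ⊢
        have hcases : (x = 3 ∧ y = 0 ∧ z = 0) ∨ (x = 0 ∧ y = 3 ∧ z = 0) ∨
            (x = 0 ∧ y = 0 ∧ z = 3) ∨ (x = 2 ∧ y = 1 ∧ z = 0) ∨ (x = 2 ∧ y = 0 ∧ z = 1) ∨
            (x = 1 ∧ y = 2 ∧ z = 0) ∨ (x = 1 ∧ y = 1 ∧ z = 1) ∨ (x = 1 ∧ y = 0 ∧ z = 2) ∨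
            (x = 0 ∧ y = 2 ∧ z = 1) ∨ (x = 0 ∧ y = 1 ∧ z = 2) := by
          clear hz
          have hx : x ≤ 3 := by omega
          have hy : y ≤ 3 := by omega
          interval_cases x <;> interval_cases y <;> omega
        clear hz hd3
        rcases hcases with h | h | h | h | h | h | h | h | h | h <;> obtain ⟨rfl, rfl, rfl⟩ := h
        exacts [⟨0, fun v => by simp⟩, ⟨1, fun v => by simp⟩, ⟨2, fun v => by simp⟩,
          ⟨3, fun v => by simp⟩, ⟨4, fun v => by simp⟩, ⟨5, fun v => by simp⟩,
          ⟨6, fun v => by simp⟩, ⟨7, fun v => by simp⟩, ⟨8, fun v => by simp⟩,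
          ⟨9, fun v => by simp⟩]
      obtain ⟨i, hi⟩ := hmon
      refine ⟨a + Pi.single i (coeff d F), fun v => ?_⟩
      rw [Finset.sum_insert hd, ha, hi]
      fin_cases i <;> simp <;> ring
  have hs : ∀ d ∈ F.support, d 0 + d 1 + d 2 = 3 := by
    intro d hd
    have h := hF.degree_eq_sum_deg_support hd
    refine Eq.trans ?_ h.symm
    rw [Finset.sum_subset (Finset.subset_univ _) (by simp), Fin.sum_univ_three]
  obtain ⟨a, ha⟩ := key F.support hs
  refine ⟨a, fun v => ?_⟩
  rw [← ha v, eval_eq']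
  simp [Fin.prod_univ_three]

theorem eval_smul_of_isHomogeneous {F : MvPolynomial (Fin 3) ℂ} (hF : F.IsHomogeneous 3) (c : ℂ)
    (v : Fin 3 → ℂ) : eval (c • v) F = c ^ 3 * eval v F := by
  obtain ⟨a, ha⟩ := exists_eval_eq_of_isHomogeneous hF
  rw [ha, ha]
  simp only [Pi.smul_apply, smul_eq_mul]
  ring

theorem Reps.eval_eq_zero_iff {x : Plane} {u v : Fin 3 → ℂ} (hu : Reps x u) (hv : Reps x v)
    {F : MvPolynomial (Fin 3) ℂ} (hF : F.IsHomogeneous 3) : eval u F = 0 ↔ eval v F = 0 := by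
  obtain ⟨c, hc, rfl⟩ := hu.exists_smul hv
  rw [eval_smul_of_isHomogeneous hF, mul_eq_zero, or_iff_right (pow_ne_zero 3 hc)]

/-- A cubic through the points of a configuration in normal form and one more point of the line
through the points with labels `0` and `1` vanishes. -/
theorem IsNormalForm.eval_eq_zero {n : ℕ} {p : ZMod n → Plane} {r s : ℂ} (h : IsNormalForm p r s)
    {F : MvPolynomial (Fin 3) ℂ} (hF : F.IsHomogeneous 3)
    (hp : ∀ k, eval (p k).rep F = 0) (he : eval ![0, 1, 2] F = 0) (v : Fin 3 → ℂ) :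
    eval v F = 0 := by
  have van : ∀ {k : ZMod n} {u : Fin 3 → ℂ}, Reps (p k) u → eval u F = 0 := fun {k u} hu =>
    ((reps_rep _).eval_eq_zero_iff hu hF).mp (hp k)
  obtain ⟨a, ha⟩ := exists_eval_eq_of_isHomogeneous hF
  have e0 := van h.p0
  have e1 := van h.p1
  have e2 := van h.p2
  have e3 := van h.p3
  have e4 := van h.p4
  have e5 := van h.p5
  have f1 := van h.m1
  have f2 := van h.m2
  have f3 := van h.m3
  rw [ha] at he e0 e1 e2 e3 e4 e5 f1 f2 f3
  simp only [Matrix.cons_val] at he e0 e1 e2 e3 e4 e5 f1 f2 f3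
  -- The coefficients 1, 2, 8, 9 are those of the restriction to the line x = 0. This binary cubic
  -- has four zeros there, the labels 0, 1, -1 and the extra point, so it vanishes.
  have a1 : a 1 = 0 := by linear_combination e0
  have a2 : a 2 = 0 := by linear_combination e1
  have a0 : a 0 = 0 := by linear_combination f2
  have a9 : a 9 = 0 := by linear_combination (he - 2 * f1 + e0 - 6 * e1) / 2
  have a8 : a 8 = 0 := by linear_combination f1 - a9 - a1 - a2
  -- What remains is x times a conic through the points with labels ±2, ±3, 4, 5.
  simp only [a0, a1, a2, a8, a9] at e2 e3 e4 e5 f3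
  have a3 : a 3 = -a 5 := by linear_combination e2
  have a4 : a 4 = -a 6 - a 7 * s := by
    apply mul_left_cancel₀ h.s_ne_zero
    linear_combination f3 - a3
  have a6 : a 6 = -a 5 := by
    apply mul_left_cancel₀ (mul_ne_zero h.s_ne_zero h.s_ne_one)
    rw [a3, a4] at e3
    linear_combination e3
  have g4 : a 5 * (1 - s) + a 7 * (s + r) = 0 := by
    apply mul_left_cancel₀ h.r_ne_zero
    rw [a3, a4, a6] at e4
    linear_combination e4
  have g5 : a 5 * (1 - s) + a 7 * s ^ 2 = 0 := by
    apply mul_left_cancel₀ (mul_ne_zero (mul_ne_zero h.s_ne_one h.r_ne_zero) h.sub_ne_zero)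
    rw [a3, a4, a6] at e5
    linear_combination e5
  -- The six points lie on no conic because r ≠ s(s - 1), which says that the points with labels 1,
  -- -4, 5 are not collinear.
  have a7 : a 7 = 0 := by
    apply mul_left_cancel₀ h.sq_ne_zero
    linear_combination g4 - g5
  have a5 : a 5 = 0 := by
    apply mul_left_cancel₀ h.s_ne_one
    rw [a7] at g4
    linear_combination -g4
  rw [ha, a0, a1, a2, a8, a9, a3, a4, a6, a7, a5]
  ring

/-! ### Linear substitutions -/

/-- The form `v ↦ F (M v)`. -/
noncomputable def subst (M : Matrix (Fin 3) (Fin 3) ℂ) :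
    MvPolynomial (Fin 3) ℂ →ₐ[ℂ] MvPolynomial (Fin 3) ℂ :=
  aeval fun i => ∑ j, C (M i j) * X j

theorem eval_subst (M : Matrix (Fin 3) (Fin 3) ℂ) (F : MvPolynomial (Fin 3) ℂ) (v : Fin 3 → ℂ) :
    eval v (subst M F) = eval (M.mulVec v) F := by
  induction F using MvPolynomial.induction_on with
  | C a => simp [subst]
  | add p q hp hq => rw [map_add, map_add, map_add, hp, hq]
  | mul_X p i hp =>
    rw [map_mul, map_mul, map_mul, hp]
    simp [subst, Matrix.mulVec, dotProduct]

theorem subst_isHomogeneous (M : Matrix (Fin 3) (Fin 3) ℂ) {F : MvPolynomial (Fin 3) ℂ} {d : ℕ}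
    (hF : F.IsHomogeneous d) : (subst M F).IsHomogeneous d := by
  have h := hF.aeval (fun i => ∑ j, C (M i j) * X j)
    (fun i => IsHomogeneous.sum Finset.univ _ 1 fun j _ => isHomogeneous_C_mul_X _ _)
  rwa [one_mul] at h

theorem pderiv_subst (M : Matrix (Fin 3) (Fin 3) ℂ) (F : MvPolynomial (Fin 3) ℂ) (j : Fin 3) :
    pderiv j (subst M F) = ∑ i, C (M i j) * subst M (pderiv i F) := by
  induction F using MvPolynomial.induction_on with
  | C a => simp [subst]
  | add p q hp hq =>
    simp only [map_add, hp, hq, mul_add, Finset.sum_add_distrib]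
  | mul_X p k hp =>
    have hX : pderiv j (subst M (X k)) = C (M k j) := by
      simp [subst, pderiv_X, Pi.single_apply]
    rw [map_mul, pderiv_mul, hp, hX]
    simp only [pderiv_mul, pderiv_X, map_add, map_mul, mul_add, Finset.sum_add_distrib,
      Finset.sum_mul, mul_assoc]
    congr 1
    simp [Pi.single_apply, mul_comm]

theorem eval_pderiv_subst (M : Matrix (Fin 3) (Fin 3) ℂ) (F : MvPolynomial (Fin 3) ℂ)
    (v : Fin 3 → ℂ) : (fun j => eval v (pderiv j (subst M F))) =
      M.transpose.mulVec (fun i => eval (M.mulVec v) (pderiv i F)) := by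
  ext j
  simp [pderiv_subst, eval_subst, Matrix.mulVec, dotProduct]

theorem isSingularAt_subst_iff {M : Matrix (Fin 3) (Fin 3) ℂ} (hM : IsUnit M)
    (F : MvPolynomial (Fin 3) ℂ) (v : Fin 3 → ℂ) :
    IsSingularAt (subst M F) v ↔ IsSingularAt F (M.mulVec v) := by
  have hT : Function.Injective M.transpose.mulVec :=
    Matrix.mulVec_injective_of_isUnit (by rwa [Matrix.isUnit_transpose])
  unfold IsSingularAt
  rw [eval_subst]
  refine and_congr_right fun _ => ?_
  have h0 := eval_pderiv_subst M F v
  constructor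
  · intro h
    have : M.transpose.mulVec (fun i => eval (M.mulVec v) (pderiv i F)) =
        M.transpose.mulVec 0 := by
      rw [← h0, Matrix.mulVec_zero]
      exact funext h
    exact fun i => congrFun (hT this) i
  · intro h j
    have : (fun i => eval (M.mulVec v) (pderiv i F)) = 0 := funext h
    rw [this, Matrix.mulVec_zero] at h0
    exact congrFun h0 j

theorem isSmoothCurve_subst {M : Matrix (Fin 3) (Fin 3) ℂ} (hM : IsUnit M)
    {F : MvPolynomial (Fin 3) ℂ} (hF : IsSmoothCurve F) : IsSmoothCurve (subst M F) := by
  intro v hv h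
  rw [isSingularAt_subst_iff hM] at h
  refine hF _ (fun h0 => hv ?_) h
  exact Matrix.mulVec_injective_of_isUnit hM (by rw [h0, Matrix.mulVec_zero])

theorem hessian_subst (M : Matrix (Fin 3) (Fin 3) ℂ) (F : MvPolynomial (Fin 3) ℂ)
    (v : Fin 3 → ℂ) :
    (Matrix.of fun i j => eval v (pderiv i (pderiv j (subst M F)))) =
      M.transpose * (Matrix.of fun i j => eval (M.mulVec v) (pderiv i (pderiv j F))) * M := by
  ext i j
  rw [Matrix.of_apply, pderiv_subst, map_sum, map_sum]
  simp only [pderiv_C_mul, pderiv_subst, map_mul, map_sum, eval_C, eval_subst, Matrix.mul_apply,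
    Matrix.transpose_apply, Matrix.of_apply]
  refine Finset.sum_congr rfl fun k _ => ?_
  rw [mul_comm]

theorem isNodalCubic_subst {M : Matrix (Fin 3) (Fin 3) ℂ} (hM : IsUnit M)
    {F : MvPolynomial (Fin 3) ℂ} (hF : IsNodalCubic F) : IsNodalCubic (subst M F) := by
  obtain ⟨v, hv, hs, huniq, hr⟩ := hF
  have hdet := (Matrix.isUnit_iff_isUnit_det M).mp hM
  have hMi : M * M⁻¹ = 1 := Matrix.mul_nonsing_inv M hdet
  have hiM : M⁻¹ * M = 1 := Matrix.nonsing_inv_mul M hdet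
  have hMv : M.mulVec (M⁻¹.mulVec v) = v := by
    rw [Matrix.mulVec_mulVec, hMi, Matrix.one_mulVec]
  refine ⟨M⁻¹.mulVec v, ?_, ?_, ?_, ?_⟩
  · intro h
    rw [h, Matrix.mulVec_zero] at hMv
    exact hv hMv.symm
  · rw [isSingularAt_subst_iff hM, hMv]
    exact hs
  · intro w hw
    rw [isSingularAt_subst_iff hM] at hw
    obtain ⟨c, hc⟩ := huniq _ hw
    refine ⟨c, ?_⟩
    rw [← Matrix.mulVec_smul, ← hc, Matrix.mulVec_mulVec, hiM, Matrix.one_mulVec]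
  · rw [hessian_subst, hMv, Matrix.rank_mul_eq_left_of_isUnit_det _ _ hdet,
      Matrix.rank_mul_eq_right_of_isUnit_det _ _ (by rwa [Matrix.det_transpose]), hr]

theorem isSingularAt_smul_iff {c : ℂ} (hc : c ≠ 0) (F : MvPolynomial (Fin 3) ℂ) (v : Fin 3 → ℂ) :
    IsSingularAt (c • F) v ↔ IsSingularAt F v := by
  simp [IsSingularAt, smul_eval, hc]

theorem isSmoothCurve_smul_iff {c : ℂ} (hc : c ≠ 0) {F : MvPolynomial (Fin 3) ℂ} :
    IsSmoothCurve (c • F) ↔ IsSmoothCurve F := by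
  simp only [IsSmoothCurve, isSingularAt_smul_iff hc]

theorem isNodalCubic_smul {c : ℂ} (hc : c ≠ 0) {F : MvPolynomial (Fin 3) ℂ}
    (hF : IsNodalCubic F) : IsNodalCubic (c • F) := by
  obtain ⟨v, hv, hs, huniq, hr⟩ := hF
  refine ⟨v, hv, (isSingularAt_smul_iff hc F v).mpr hs,
    fun w hw => huniq w ((isSingularAt_smul_iff hc F w).mp hw), ?_⟩
  have : (Matrix.of fun i j => eval v (pderiv i (pderiv j (c • F)))) =
      (Matrix.scalar (Fin 3) c) * (Matrix.of fun i j => eval v (pderiv i (pderiv j F))) := by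
    ext i j
    simp [smul_eval]
  rw [this, Matrix.rank_mul_eq_right_of_isUnit_det _ _ (by simp [hc]), hr]

theorem IsNodalCubic.not_isSmoothCurve {F : MvPolynomial (Fin 3) ℂ} (hF : IsNodalCubic F) :
    ¬ IsSmoothCurve F := by
  obtain ⟨v, hv, hs, -⟩ := hF
  exact fun h => h v hv hs

/-! ### Uniqueness of the cubic -/

theorem vanishes_subst_iff {n : ℕ} {p q : ZMod n → Plane} {g : GL (Fin 3) ℂ}
    (h : ∀ k, (Matrix.ProjGenLinGroup.mk g : PGL(3, ℂ)) • p k = q k)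
    {F : MvPolynomial (Fin 3) ℂ} (hF : F.IsHomogeneous 3) :
    (∀ k, eval (p k).rep (subst g.val F) = 0) ↔ ∀ k, eval (q k).rep F = 0 := by
  refine forall_congr' fun k => ?_
  rw [eval_subst]
  exact (h k ▸ (reps_rep (p k)).mk_smul g).eval_eq_zero_iff (reps_rep (q k)) hF

/-- Evaluation at the extra point `e` is injective on the space of cubics through the configuration,
so this space has dimension at most one. -/
theorem IsTorsionConfig.isUniqueCubicThrough {n : ℕ} (hn : 10 ≤ n) {p : ZMod n → Plane}
    (hp : IsTorsionConfig p) {F : MvPolynomial (Fin 3) ℂ} (hF : F.IsHomogeneous 3) (hF0 : F ≠ 0)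
    (hFp : ∀ k, eval (p k).rep F = 0) : IsUniqueCubicThrough F p := by
  obtain ⟨g, q, r, s, hgq, hq⟩ := hp.exists_normalForm hn
  have hgq' : ∀ k, (Matrix.ProjGenLinGroup.mk g⁻¹ : PGL(3, ℂ)) • q k = p k := by
    intro k
    rw [map_inv, inv_smul_eq_iff, hgq]
  set e : Fin 3 → ℂ := (g⁻¹).val.mulVec ![0, 1, 2]
  have van : ∀ G : MvPolynomial (Fin 3) ℂ, G.IsHomogeneous 3 → (∀ k, eval (p k).rep G = 0) →
      eval e G = 0 → G = 0 := by
    intro G hG hGp he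
    refine MvPolynomial.funext fun v => ?_
    have h := hq.eval_eq_zero (subst_isHomogeneous (g⁻¹).val hG)
      ((vanishes_subst_iff hgq' hG).mpr hGp) (by rw [eval_subst]; exact he) (g.val.mulVec v)
    rw [eval_subst, Matrix.mulVec_mulVec, ← Units.val_mul, inv_mul_cancel, Units.val_one,
      Matrix.one_mulVec] at h
    rw [h, map_zero]
  refine ⟨hF, hF0, hFp, fun G hG hGp => ⟨eval e G / eval e F, ?_⟩⟩
  have he : eval e F ≠ 0 := fun h => hF0 (van F hF hFp h)
  rw [← sub_eq_zero]
  refine van _ (hG.sub ?_) (fun k => ?_) ?_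
  · rw [smul_eq_C_mul]
    exact hF.C_mul _
  · rw [map_sub, smul_eval, hGp, hFp, mul_zero, sub_zero]
  · rw [map_sub, smul_eval, div_mul_cancel₀ _ he, sub_self]

theorem IsUniqueCubicThrough.exists_ne_zero_smul {n : ℕ} {p : ZMod n → Plane}
    {F G : MvPolynomial (Fin 3) ℂ} (hF : IsUniqueCubicThrough F p) (hG : G.IsHomogeneous 3)
    (hG0 : G ≠ 0) (hGp : ∀ k, eval (p k).rep G = 0) : ∃ c : ℂ, c ≠ 0 ∧ F = c • G := by
  obtain ⟨c, rfl⟩ := hF.unique G hG hGp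
  have hc : c ≠ 0 := by
    rintro rfl
    simp at hG0
  exact ⟨c⁻¹, inv_ne_zero hc, by rw [smul_smul, inv_mul_cancel₀ hc, one_smul]⟩

theorem subst_ne_zero {M : Matrix (Fin 3) (Fin 3) ℂ} (hM : IsUnit M)
    {F : MvPolynomial (Fin 3) ℂ} (hF : F ≠ 0) : subst M F ≠ 0 := by
  intro h
  refine hF (MvPolynomial.funext fun v => ?_)
  have hMi : M * M⁻¹ = 1 := Matrix.mul_nonsing_inv M ((Matrix.isUnit_iff_isUnit_det M).mp hM)
  have h1 := congrArg (eval (M⁻¹.mulVec v)) h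
  rwa [eval_subst, Matrix.mulVec_mulVec, hMi, Matrix.one_mulVec, map_zero] at h1

/-! ### Weierstrass cubics as forms -/

theorem weierstrass_isHomogeneous (W : WeierstrassCurve ℂ) :
    W.toProjective.polynomial.IsHomogeneous 3 := by
  have hX := fun i => isHomogeneous_X ℂ (i : Fin 3)
  have hC := fun a : ℂ => isHomogeneous_C (Fin 3) a
  rw [WeierstrassCurve.Projective.polynomial]
  refine IsHomogeneous.sub (IsHomogeneous.add (IsHomogeneous.add ?_ ?_) ?_)
    (IsHomogeneous.add (IsHomogeneous.add (IsHomogeneous.add ?_ ?_) ?_) ?_)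
  · exact ((hX 1).pow 2).mul (hX 2)
  · exact (((hC _).mul (hX 0)).mul (hX 1)).mul (hX 2)
  · exact ((hC _).mul (hX 1)).mul ((hX 2).pow 2)
  · exact (hX 0).pow 3
  · exact ((hC _).mul ((hX 0).pow 2)).mul (hX 2)
  · exact ((hC _).mul (hX 0)).mul ((hX 2).pow 2)
  · exact (hC _).mul ((hX 2).pow 3)

theorem weierstrass_ne_zero (W : WeierstrassCurve ℂ) : W.toProjective.polynomial ≠ 0 := by
  intro h
  have := congrArg (eval ![1, 0, 0]) h
  rw [WeierstrassCurve.Projective.eval_polynomial] at this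
  simp at this

theorem eval_coords {W : WeierstrassCurve ℂ} (P : W.toAffine.Point) :
    eval (coords P) W.toProjective.polynomial = 0 := by
  rcases P with _ | ⟨x, y, h⟩
  · exact WeierstrassCurve.Projective.equation_zero
  · exact (WeierstrassCurve.Projective.equation_some x y).mpr h.1

theorem isSmoothCurve_weierstrass {W : WeierstrassCurve ℂ} (hW : W.Δ ≠ 0) :
    IsSmoothCurve W.toProjective.polynomial := by
  rintro v hv ⟨h0, h1⟩
  have hE : W.toProjective.Equation v := h0
  have hN : W.toProjective.Nonsingular v := by
    by_cases hz : v 2 = 0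
    · have hx := WeierstrassCurve.Projective.X_eq_zero_of_Z_eq_zero hE hz
      rw [WeierstrassCurve.Projective.nonsingular_of_Z_eq_zero hz]
      refine ⟨hE, Or.inr ?_⟩
      rw [hx]
      have hy : v 1 ≠ 0 := by
        intro hy
        apply hv
        ext i
        fin_cases i
        · exact hx
        · exact hy
        · exact hz
      simpa using hy
    · rw [WeierstrassCurve.Projective.nonsingular_of_Z_ne_zero hz]
      rw [WeierstrassCurve.Projective.equation_of_Z_ne_zero hz] at hE
      exact (WeierstrassCurve.Affine.equation_iff_nonsingular_of_Δ_ne_zero hW).mp hE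
  rcases hN.2 with h | h | h
  · exact h (h1 0)
  · exact h (h1 1)
  · exact h (h1 2)

/-! ### The standard nodal cubic -/

/-- A nodal cubic form. -/
noncomputable def nodalForm : MvPolynomial (Fin 3) ℂ := X 0 * X 1 * X 2 - X 1 ^ 3 + X 2 ^ 3

/-- A parametrization of the smooth points of the standard nodal cubic by nonzero numbers. -/
def nodalParam (w : ℂ) : Fin 3 → ℂ := ![1 - w ^ 3, w, w ^ 2]

theorem nodalForm_isHomogeneous : nodalForm.IsHomogeneous 3 := by
  have hX := fun i => isHomogeneous_X ℂ (i : Fin 3)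
  exact ((((hX 0).mul (hX 1)).mul (hX 2)).sub ((hX 1).pow 3)).add ((hX 2).pow 3)

theorem nodalForm_ne_zero : nodalForm ≠ 0 := by
  intro h
  have := congrArg (eval ![0, 0, 1]) h
  simp [nodalForm] at this

theorem eval_nodalParam (w : ℂ) : eval (nodalParam w) nodalForm = 0 := by
  simp [nodalForm, nodalParam]
  ring

theorem isNodalCubic_nodalForm : IsNodalCubic nodalForm := by
  refine ⟨![1, 0, 0], fun h => one_ne_zero (congrFun h 0), ⟨?_, ?_⟩, ?_, ?_⟩
  · simp [nodalForm]
  · intro i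
    fin_cases i <;> simp [nodalForm, pderiv_X]
  · rintro w ⟨-, h⟩
    have h0 := h 0
    have h1 := h 1
    have h2 := h 2
    simp [nodalForm, pderiv_X] at h0 h1 h2
    have h12 : w 1 = 0 ∧ w 2 = 0 := by
      rcases h0 with h0 | h0 <;> simp_all
    refine ⟨w 0, ?_⟩
    ext i
    fin_cases i <;> simp [h12]
  · have h : (Matrix.of fun i j => eval ![1, 0, 0] (pderiv i (pderiv j nodalForm))) =
        !![1, 0, 0; 0, 0, 1; 0, 1, 0] * Matrix.diagonal ![0, 1, 1] := by
      ext i j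
      fin_cases i <;> fin_cases j <;>
        simp [nodalForm, pderiv_X, Pi.single_apply, Matrix.mul_apply,
          Matrix.diagonal]
    rw [h, Matrix.rank_mul_eq_right_of_isUnit_det _ _ (by simp [Matrix.det_fin_three]),
      Matrix.rank_diagonal]
    have : (fun i : Fin 3 => (![0, 1, 1] : Fin 3 → ℂ) i ≠ 0) = fun i => i ≠ 0 := by
      ext i
      fin_cases i <;> simp
    simp only [this]
    decide

/-! ### Configurations on the standard nodal cubic -/

/-- The factor 1 - abc is the multiplicative group law: points with distinct parameters are
collinear exactly when the product of the parameters is 1. -/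
theorem det3_nodalParam (a b c : ℂ) : det3 (nodalParam a) (nodalParam b) (nodalParam c) =
    (b - a) * (c - a) * (c - b) * (1 - a * b * c) := by
  simp only [det3, nodalParam, Matrix.cons_val]
  ring

theorem pow_val_eq_iff {n : ℕ} [NeZero n] {q : ℂ} (hq : IsPrimitiveRoot q n) (i j : ZMod n) :
    q ^ i.val = q ^ j.val ↔ i = j := by
  refine ⟨fun h => ?_, fun h => by rw [h]⟩
  exact ZMod.val_injective n (hq.pow_inj i.val_lt j.val_lt h)

theorem pow_val_mul_eq_one_iff {n : ℕ} [NeZero n] {q : ℂ} (hq : IsPrimitiveRoot q n)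
    (i j k : ZMod n) : q ^ i.val * q ^ j.val * q ^ k.val = 1 ↔ i + j + k = 0 := by
  rw [← pow_add, ← pow_add, hq.pow_eq_one_iff_dvd, ← ZMod.natCast_eq_zero_iff]
  push_cast
  simp

theorem isTorsionConfig_of_reps_nodalParam {n : ℕ} (hn : 10 ≤ n) {q : ℂ}
    (hq : IsPrimitiveRoot q n) {p : ZMod n → Plane} (h : ∀ k, Reps (p k) (nodalParam (q ^ k.val))) :
    IsTorsionConfig p := by
  have : NeZero n := ⟨by omega⟩
  refine isTorsionConfig_of_reps h fun i j k hij hik hjk => ?_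
  have hne : ∀ {i j : ZMod n}, i ≠ j → q ^ j.val - q ^ i.val ≠ 0 := fun {i j} hij h =>
    hij ((pow_val_eq_iff hq i j).mp (sub_eq_zero.mp h).symm)
  rw [det3_nodalParam, mul_eq_zero, or_iff_right (mul_ne_zero (mul_ne_zero (hne hij) (hne hik))
    (hne hjk)), sub_eq_zero, eq_comm, pow_val_mul_eq_one_iff hq]

/-- `hom_of_sum_eq_zero` in the multiplicative group ℂˣ, written additively; distinctness of the
points makes the root primitive. -/
theorem IsTorsionConfig.exists_isPrimitiveRoot {n : ℕ} (hn : 10 ≤ n) {p : ZMod n → Plane}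
    (hp : IsTorsionConfig p) {w : ZMod n → ℂ} (hw : ∀ k, w k ≠ 0) (h0 : w 0 = 1)
    (h : ∀ k, Reps (p k) (nodalParam (w k))) :
    ∃ q, IsPrimitiveRoot q n ∧ ∀ k, w k = q ^ k.val := by
  have hne : ∀ {i j : ZMod n}, i ≠ j → w j - w i ≠ 0 := fun {i j} hij h' =>
    hij (hp.injective hn ((h i).eq (by rw [← sub_eq_zero.mp h']; exact h j)))
  obtain ⟨h1, h2⟩ := hom_of_sum_eq_zero hn (G := Additive ℂˣ)
    (f := fun k => Additive.ofMul (Units.mk0 (w k) (hw k)))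
    (by simp [h0]) (fun i j k hij hik hjk hs => by
      have h' := (hp.det3_eq_zero_iff hij hik hjk (h i) (h j) (h k)).mpr hs
      rw [det3_nodalParam, mul_eq_zero, or_iff_right (mul_ne_zero (mul_ne_zero (hne hij) (hne hik))
        (hne hjk)), sub_eq_zero] at h'
      rw [← ofMul_mul, ← ofMul_mul, ofMul_eq_zero, ← Units.val_inj]
      simpa using h'.symm)
  simp only [← ofMul_pow, ofMul_eq_zero, Equiv.apply_eq_iff_eq, ← Units.val_inj,
    Units.val_pow_eq_pow_val, Units.val_mk0, Units.val_one] at h1 h2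
  refine ⟨w 1, IsPrimitiveRoot.mk_of_lt _ (by omega) h1 fun m hm0 hm h' => ?_, h2⟩
  have h3 := h2 m
  rw [ZMod.val_natCast_of_lt hm, h', ← h0] at h3
  have h4 : (0 : ZMod n) = m := by
    by_contra hne'
    exact hne hne' (sub_eq_zero.mpr h3)
  rw [eq_comm, ZMod.natCast_eq_zero_iff] at h4
  exact absurd (Nat.le_of_dvd hm0 h4) (by omega)

/-- A parametrization of the smooth points of a cuspidal cubic. -/
def cuspParam (s : ℂ) : Fin 3 → ℂ := ![s, 1, s ^ 3]

/-- Here the last factor is the additive group law of ℂ. -/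
theorem det3_cuspParam (a b c : ℂ) : det3 (cuspParam a) (cuspParam b) (cuspParam c) =
    (b - a) * (c - a) * (c - b) * (-(a + b + c)) := by
  simp only [det3, cuspParam, Matrix.cons_val]
  ring

/-- The parameters would form a subgroup of order n in ℂ, which has no torsion. -/
theorem IsTorsionConfig.not_cuspParam {n : ℕ} (hn : 10 ≤ n) {p : ZMod n → Plane}
    (hp : IsTorsionConfig p) {s : ZMod n → ℂ} (h0 : s 0 = 0)
    (h : ∀ k, Reps (p k) (cuspParam (s k))) : False := by
  have hne : ∀ {i j : ZMod n}, i ≠ j → s j - s i ≠ 0 := fun {i j} hij h' =>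
    hij (hp.injective hn ((h i).eq (by rw [← sub_eq_zero.mp h']; exact h j)))
  obtain ⟨h1, h2⟩ := hom_of_sum_eq_zero hn (f := s) h0 (fun i j k hij hik hjk hs => by
      have h' := (hp.det3_eq_zero_iff hij hik hjk (h i) (h j) (h k)).mpr hs
      rwa [det3_cuspParam, mul_eq_zero, or_iff_right (mul_ne_zero (mul_ne_zero (hne hij) (hne hik))
        (hne hjk)), neg_eq_zero] at h')
  rw [nsmul_eq_mul, mul_eq_zero, or_iff_right (by norm_cast; omega)] at h1
  have : Fact (1 < n) := ⟨by omega⟩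
  exact hne (zero_ne_one (α := ZMod n)) (by rw [h0, h1, sub_zero])

theorem Reps.mk_inv_smul {x : Plane} {v : Fin 3 → ℂ} {g : GL (Fin 3) ℂ}
    (h : Reps x (g.val.mulVec v)) : Reps ((Matrix.ProjGenLinGroup.mk g⁻¹ : PGL(3, ℂ)) • x) v := by
  have h' := h.mk_smul g⁻¹
  rwa [Matrix.mulVec_mulVec, ← Units.val_mul, inv_mul_cancel, Units.val_one,
    Matrix.one_mulVec] at h'

/-! ### Singular Weierstrass cubics -/

/-- The discriminant of the two-torsion polynomial 4x³ + b₂x² + 2b₄x + b₆ is a multiple of Δ. Hence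
it has the form 4(x - e)²(x - e'), and comparing coefficients gives the equations. -/
theorem exists_double_root {W : WeierstrassCurve ℂ} (hW : W.Δ = 0) :
    ∃ e e' : ℂ, W.b₂ = -4 * (2 * e + e') ∧ W.b₄ = 2 * (e ^ 2 + 2 * e * e') ∧
      W.b₆ = -4 * (e ^ 2 * e') := by
  have ha : W.twoTorsionPolynomial.a ≠ 0 := by
    simp [WeierstrassCurve.twoTorsionPolynomial]
  obtain ⟨x, y, z, h3⟩ := (Cubic.splits_iff_roots_eq_three (φ := RingHom.id ℂ) ha).mp
    (IsAlgClosed.splits _)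
  have hd : ¬ (x ≠ y ∧ x ≠ z ∧ y ≠ z) := by
    rw [← Cubic.discr_ne_zero_iff_roots_ne ha h3, WeierstrassCurve.twoTorsionPolynomial_discr, hW]
    simp
  have hb := Cubic.b_eq_three_roots ha h3
  have hc := Cubic.c_eq_three_roots ha h3
  have hd' := Cubic.d_eq_three_roots ha h3
  simp only [WeierstrassCurve.twoTorsionPolynomial, RingHom.id_apply] at hb hc hd'
  have key : ∃ e e', (x + y + z = 2 * e + e' ∧ x * y + x * z + y * z = e ^ 2 + 2 * e * e' ∧
      x * y * z = e ^ 2 * e') := by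
    by_cases h1 : x = y
    · subst h1
      exact ⟨x, z, by ring, by ring, by ring⟩
    by_cases h2 : x = z
    · subst h2
      exact ⟨x, y, by ring, by ring, by ring⟩
    by_cases h4 : y = z
    · subst h4
      exact ⟨y, x, by ring, by ring, by ring⟩
    exact absurd ⟨h1, h2, h4⟩ hd
  obtain ⟨e, e', k1, k2, k3⟩ := key
  refine ⟨e, e', ?_, ?_, ?_⟩
  · linear_combination hb - 4 * k1
  · linear_combination hc / 2 + 2 * k2
  · linear_combination hd' - 4 * k3

/-- Completing the square and moving `e` to `0`. -/
noncomputable def shiftMatrix (W : WeierstrassCurve ℂ) (e : ℂ) : GL (Fin 3) ℂ :=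
  Matrix.GeneralLinearGroup.mkOfDetNeZero
    !![1, 0, -e; W.a₁ / 2, 1, W.a₃ / 2; 0, 0, 1] (by simp [Matrix.det_fin_three])

theorem shiftMatrix_mulVec (W : WeierstrassCurve ℂ) (e : ℂ) (v : Fin 3 → ℂ) :
    (shiftMatrix W e).val.mulVec v =
      ![v 0 - e * v 2, v 1 + (W.a₁ * v 0 + W.a₃ * v 2) / 2, v 2] := by
  ext i
  fin_cases i <;> simp [shiftMatrix, Matrix.GeneralLinearGroup.mkOfDetNeZero, Matrix.mulVec,
    dotProduct, Fin.sum_univ_three] <;> ring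

/-- The points of a Weierstrass curve with a singular point, after completing the square. -/
theorem reps_shiftMatrix {W : WeierstrassCurve ℂ} {e e' : ℂ} (h2 : W.b₂ = -4 * (2 * e + e'))
    (h4 : W.b₄ = 2 * (e ^ 2 + 2 * e * e')) (h6 : W.b₆ = -4 * (e ^ 2 * e'))
    (Q : W.toAffine.Point) :
    (Q = 0 ∧ Reps ((Matrix.ProjGenLinGroup.mk (shiftMatrix W e) : PGL(3, ℂ)) • toPlane Q)
      ![0, 1, 0]) ∨
    (Q ≠ 0 ∧ ∃ t, t ^ 2 + e' - e ≠ 0 ∧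
      Reps ((Matrix.ProjGenLinGroup.mk (shiftMatrix W e) : PGL(3, ℂ)) • toPlane Q)
        ![t ^ 2 + e' - e, t * (t ^ 2 + e' - e), 1]) := by
  have h := (reps_toPlane Q).mk_smul (shiftMatrix W e)
  rw [shiftMatrix_mulVec] at h
  rcases Q with _ | ⟨x, y, hQ⟩
  · left
    refine ⟨rfl, ?_⟩
    simpa [coords] using h
  · right
    refine ⟨WeierstrassCurve.Affine.Point.some_ne_zero hQ, ?_⟩
    simp only [WeierstrassCurve.b₂, WeierstrassCurve.b₄, WeierstrassCurve.b₆] at h2 h4 h6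
    obtain ⟨hE, hN⟩ := (W.toAffine.nonsingular_iff' x y).mp hQ
    rw [WeierstrassCurve.Affine.equation_iff'] at hE
    set Y := y + (W.a₁ * x + W.a₃) / 2 with hY
    have hY2 : Y ^ 2 = (x - e) ^ 2 * (x - e') := by
      rw [hY]
      linear_combination hE + x ^ 2 / 4 * h2 + x / 2 * h4 + h6 / 4
    -- The singular point is the one with x = e and Y = 0.
    have hx : x - e ≠ 0 := by
      intro hx
      rw [hx] at hY2
      have hY0 : Y = 0 := by
        apply pow_eq_zero_iff (two_ne_zero) |>.mp
        rw [hY2]; ring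
      rcases hN with hN | hN
      · apply hN
        obtain rfl : x = e := by linear_combination hx
        linear_combination W.a₁ * hY0 - x / 2 * h2 - h4 / 2
      · apply hN
        linear_combination 2 * hY0
    -- The slope of the line to the singular point parametrizes the curve: t² = x - e'.
    obtain ⟨t, ht⟩ : ∃ t, t = Y / (x - e) := ⟨_, rfl⟩
    have hYt : Y = t * (x - e) := by rw [ht, div_mul_cancel₀ _ hx]
    have ht2 : t ^ 2 + e' - e = x - e := by
      apply mul_left_cancel₀ (pow_ne_zero 2 hx)
      rw [hYt] at hY2
      linear_combination hY2
    refine ⟨t, by rwa [ht2], ?_⟩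
    rw [ht2, ← hYt]
    simpa [coords, hY] using h

/-- A triple root of the two-torsion polynomial gives a cusp, excluded by
`IsTorsionConfig.not_cuspParam`; a root that is only double gives a node, with group ℂˣ. -/
theorem exists_nodalParam_of_Δ_eq_zero {n : ℕ} (hn : 10 ≤ n) {W : WeierstrassCurve ℂ}
    (hW : W.Δ = 0) (P : W.toAffine.Point) (hP : addOrderOf P = n) :
    ∃ (g : GL (Fin 3) ℂ) (q : ℂ), IsPrimitiveRoot q n ∧ ∀ k : ZMod n,
      Reps ((Matrix.ProjGenLinGroup.mk g : PGL(3, ℂ)) • toPlane (k.val • P))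
        (nodalParam (q ^ k.val)) := by
  have : NeZero n := ⟨by omega⟩
  have hc := isTorsionConfig_multiples hn P hP
  obtain ⟨e, e', h2, h4, h6⟩ := exists_double_root hW
  have hrep := reps_shiftMatrix h2 h4 h6
  have hc' := hc.mk_smul (shiftMatrix W e) (fun _ => rfl)
  by_cases hee : e = e'
  · subst hee
    exfalso
    have hex : ∀ k : ZMod n, ∃ s : ℂ, (k = 0 → s = 0) ∧
        Reps ((Matrix.ProjGenLinGroup.mk (shiftMatrix W e) : PGL(3, ℂ)) • toPlane (k.val • P))
          (cuspParam s) := by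
      intro k
      rcases hrep (k.val • P) with ⟨-, h⟩ | ⟨h0, t, ht, h⟩
      · exact ⟨0, fun _ => rfl, h.normalize 1 one_ne_zero (by simp [cuspParam])
          (by simp [cuspParam]) (by simp [cuspParam])⟩
      · rw [add_sub_cancel_right] at ht h
        have ht0 : t ≠ 0 := fun h => ht (by rw [h]; ring)
        -- The inverse slope is the additive parameter, with the neutral element (t = ∞) at 0.
        refine ⟨1 / t, ?_, h.normalize (1 / t ^ 3) (by simp [ht0]) ?_ ?_ ?_⟩
        · rintro rfl
          simp at h0
        · simp [cuspParam]; field_simp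
        · simp [cuspParam]; field_simp
        · simp [cuspParam]
    choose s hs0 hs using hex
    exact hc'.not_cuspParam hn (hs0 0 rfl) hs
  · obtain ⟨δ, hδ⟩ := IsAlgClosed.exists_pow_nat_eq (e - e') (n := 2) (by norm_num)
    have hδ0 : δ ≠ 0 := by
      rintro rfl
      exact hee (by linear_combination -hδ)
    -- The tangent slopes at the node are ±δ, so the multiplicative parameter is w = (t - δ) / (t +
    -- δ), with w = 1 at t = ∞. Substituting t = δ(1 + w) / (1 - w) into (t² - δ² : t(t² - δ²) : 1)
    -- and clearing denominators gives the columns of `M`.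
    set M : GL (Fin 3) ℂ := Matrix.GeneralLinearGroup.mkOfDetNeZero
      !![0, 4 * δ ^ 2, -(4 * δ ^ 2); 0, 4 * δ ^ 3, 4 * δ ^ 3; 1, -3, 3] (by
        have : (32 : ℂ) * δ ^ 5 ≠ 0 := by simp [hδ0]
        simp only [Matrix.det_fin_three, Matrix.of_apply, Matrix.cons_val]
        intro h
        exact this (by linear_combination h)) with hM
    have hMv : ∀ w, M.val.mulVec (nodalParam w) =
        ![4 * δ ^ 2 * (w - w ^ 2), 4 * δ ^ 3 * (w + w ^ 2), (1 - w) ^ 3] := by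
      intro w
      ext i
      fin_cases i <;> simp [hM, nodalParam, Matrix.GeneralLinearGroup.mkOfDetNeZero,
        Matrix.mulVec, dotProduct, Fin.sum_univ_three] <;> ring
    have hex : ∀ k : ZMod n, ∃ w : ℂ, w ≠ 0 ∧ (k = 0 → w = 1) ∧
        Reps ((Matrix.ProjGenLinGroup.mk (M⁻¹ * shiftMatrix W e) : PGL(3, ℂ)) •
          toPlane (k.val • P)) (nodalParam w) := by
      intro k
      rw [map_mul, mul_smul]
      rcases hrep (k.val • P) with ⟨-, h⟩ | ⟨h0, t, ht, h⟩
      · refine ⟨1, one_ne_zero, fun _ => rfl, Reps.mk_inv_smul ?_⟩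
        rw [hMv]
        exact h.normalize (8 * δ ^ 3) (by simp [hδ0]) (by simp) (by simp; ring) (by simp)
      · have htt : t ^ 2 + e' - e = (t - δ) * (t + δ) := by linear_combination hδ
        rw [htt] at ht h
        have h1 := left_ne_zero_of_mul ht
        have h2 := right_ne_zero_of_mul ht
        refine ⟨(t - δ) / (t + δ), div_ne_zero h1 h2, ?_, Reps.mk_inv_smul ?_⟩
        · rintro rfl
          simp at h0
        · rw [hMv]
          refine h.normalize (8 * δ ^ 3 / (t + δ) ^ 3) (by simp [hδ0, h2]) ?_ ?_ ?_
          · simp; field_simp; ring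
          · simp; field_simp; ring
          · simp; field_simp; ring
    choose w hw0 hw1 hw using hex
    have hc'' := hc.mk_smul (M⁻¹ * shiftMatrix W e) (fun _ => rfl)
    obtain ⟨q, hq, hwq⟩ := hc''.exists_isPrimitiveRoot hn hw0 (hw1 0 rfl) hw
    exact ⟨M⁻¹ * shiftMatrix W e, q, hq, fun k => by rw [← hwq]; exact hw k⟩

/-! ### The explicit configurations -/

/-- The linear forms that give the explicit configuration on the standard nodal cubic. -/
noncomputable def nodalMatrix (q : ℂ) : Matrix (Fin 3) (Fin 3) ℂ :=
  -- The factors `A` and `B` scale the last two forms so that they agree at w = q⁻³, which sends the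
  -- label -3 to (0 : 1 : 1).
  let A := (1 - q ^ 2) * (1 + q ^ 3) / (1 - q ^ 5)
  let B := (1 - q + q ^ 2) / (1 + q ^ 2)
  !![1, -(1 / q + 1 / q ^ 2 + q ^ 3), 1 / q ^ 3 + q ^ 2 + q;
    A, -(A * (1 + q ^ 2 + 1 / q ^ 2)), A * (1 + q ^ 2 + 1 / q ^ 2);
    B, -(B * (1 + q + 1 / q)), B * (1 + q + 1 / q)]

/-- The coordinate lines pass through the labels {1, 2, -3}, {0, 2, -2} and {0, 1, -1}: on the nodal
cubic each form becomes a cubic in w whose roots are the corresponding powers of q, with product 1.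
-/
theorem nodalMatrix_mulVec {q : ℂ} (hq : q ≠ 0) (w : ℂ) :
    (nodalMatrix q).mulVec (nodalParam w) =
      ![(1 - w / q) * (1 - w / q ^ 2) * (1 - q ^ 3 * w),
        (1 - q ^ 2) * (1 + q ^ 3) / (1 - q ^ 5) * ((1 - w) * (1 - q ^ 2 * w) * (1 - w / q ^ 2)),
        (1 - q + q ^ 2) / (1 + q ^ 2) * ((1 - w) * (1 - q * w) * (1 - w / q))] := by
  ext i
  fin_cases i
  · simp [nodalMatrix, nodalParam, Matrix.mulVec, dotProduct, Fin.sum_univ_three]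
    field_simp
    ring
  · simp only [nodalMatrix, nodalParam, Matrix.mulVec, dotProduct, Fin.sum_univ_three]
    generalize (1 - q ^ 2) * (1 + q ^ 3) / (1 - q ^ 5) = A
    simp
    field_simp
    ring
  · simp only [nodalMatrix, nodalParam, Matrix.mulVec, dotProduct, Fin.sum_univ_three]
    generalize (1 - q + q ^ 2) / (1 + q ^ 2) = B
    simp
    field_simp
    ring

/-- The last two lines meet at `nodalParam 1`, so the determinant is the value of the first form
there, times `A * B` and the difference of the middle coefficients. -/
theorem det_nodalMatrix {q : ℂ} (hq : q ≠ 0) : (nodalMatrix q).det =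
    (1 - q ^ 2) * (1 + q ^ 3) / (1 - q ^ 5) * ((1 - q + q ^ 2) / (1 + q ^ 2)) *
      ((q ^ 3 - 1) * (q - 1) / q ^ 2 * ((1 - 1 / q) * (1 - 1 / q ^ 2) * (1 - q ^ 3))) := by
  simp only [nodalMatrix]
  generalize (1 - q ^ 2) * (1 + q ^ 3) / (1 - q ^ 5) = A
  generalize (1 - q + q ^ 2) / (1 + q ^ 2) = B
  simp only [Matrix.det_fin_three, Matrix.of_apply, Matrix.cons_val]
  field_simp
  ring

theorem det_nodalMatrix_ne_zero {n : ℕ} (hn : 10 ≤ n) {q : ℂ} (hq : IsPrimitiveRoot q n) :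
    (nodalMatrix q).det ≠ 0 := by
  have hq0 : q ≠ 0 := hq.ne_zero (by omega)
  have hpow : ∀ m : ℕ, 0 < m → m < n → 1 - q ^ m ≠ 0 := fun m h0 h h' =>
    hq.pow_ne_one_of_pos_of_lt h0.ne' h (by linear_combination -h')
  have h1 := hpow 1 (by omega) (by omega)
  rw [pow_one] at h1
  have h2 := hpow 2 (by omega) (by omega)
  have h3 := hpow 3 (by omega) (by omega)
  have h4 := hpow 4 (by omega) (by omega)
  have h5 := hpow 5 (by omega) (by omega)
  have h6 := hpow 6 (by omega) (by omega)
  have k3 : 1 + q ^ 3 ≠ 0 := fun h => h6 (by linear_combination (1 - q ^ 3) * h)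
  have k2 : 1 + q ^ 2 ≠ 0 := fun h => h4 (by linear_combination (1 - q ^ 2) * h)
  have k1 : 1 - q + q ^ 2 ≠ 0 := fun h => k3 (by linear_combination (1 + q) * h)
  have l1 : 1 - 1 / q ≠ 0 := fun h => h1 (by field_simp at h; linear_combination -h)
  have l2 : 1 - 1 / q ^ 2 ≠ 0 := fun h => h2 (by field_simp at h; linear_combination -h)
  have m1 : q - 1 ≠ 0 := fun h => h1 (by linear_combination -h)
  have m3 : q ^ 3 - 1 ≠ 0 := fun h => h3 (by linear_combination -h)
  rw [det_nodalMatrix hq0]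
  simp only [ne_eq, mul_eq_zero, div_eq_zero_iff, h2, h3, h5, k1, k2, k3,
    l1, l2, m1, m3, hq0, or_self, not_false_eq_true, pow_eq_zero_iff, OfNat.ofNat_ne_zero]

theorem reps_nodalConfig {n : ℕ} (hn : 10 ≤ n) {a : ℕ} {q : ℂ} (hq : IsPrimitiveRoot q n)
    (hqa : Complex.exp (2 * Real.pi * Complex.I / n) ^ a = q) (k : ZMod n) :
    Reps (nodalConfig n a k) ((nodalMatrix q).mulVec (nodalParam (q ^ k.val))) := by
  have : NeZero n := ⟨by omega⟩
  have hq0 : q ≠ 0 := hq.ne_zero (by omega)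
  have hpow : ∀ m : ℕ, 0 < m → m < n → 1 - q ^ m ≠ 0 := fun m h0 h h' =>
    hq.pow_ne_one_of_pos_of_lt h0.ne' h (by linear_combination -h')
  have h1 := hpow 1 (by omega) (by omega)
  rw [pow_one] at h1
  have h2 := hpow 2 (by omega) (by omega)
  have h3 := hpow 3 (by omega) (by omega)
  have h4 := hpow 4 (by omega) (by omega)
  have h5 := hpow 5 (by omega) (by omega)
  have h6 := hpow 6 (by omega) (by omega)
  have k3 : 1 + q ^ 3 ≠ 0 := fun h => h6 (by linear_combination (1 - q ^ 3) * h)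
  have k2 : 1 + q ^ 2 ≠ 0 := fun h => h4 (by linear_combination (1 - q ^ 2) * h)
  have k1 : 1 - q + q ^ 2 ≠ 0 := fun h => k3 (by linear_combination (1 + q) * h)
  have c1 : ((1 : ℕ) : ZMod n) = 1 := by norm_cast
  have hv1 : (1 : ZMod n).val = 1 := by rw [← c1, ZMod.val_natCast_of_lt (by omega)]
  have c2 : ((2 : ℕ) : ZMod n) = 2 := by norm_cast
  have hv2 : (2 : ZMod n).val = 2 := by rw [← c2, ZMod.val_natCast_of_lt (by omega)]
  have hv3 : q ^ (-3 : ZMod n).val * q ^ 3 = 1 := by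
    rw [← pow_add, hq.pow_eq_one_iff_dvd, ← ZMod.natCast_eq_zero_iff]
    push_cast
    simp
  have hk1 : q ^ k.val = q ↔ k = 1 := by
    rw [← pow_val_eq_iff hq k 1, hv1, pow_one]
  have hk2 : q ^ k.val = q ^ 2 ↔ k = 2 := by
    rw [← pow_val_eq_iff hq k 2, hv2]
  have hk3 : q ^ k.val * q ^ 3 = 1 ↔ k = -3 := by
    rw [← pow_val_eq_iff hq k (-3), ← hv3]
    exact mul_left_inj' (pow_ne_zero 3 hq0)
  rw [nodalMatrix_mulVec hq0]
  have he : ∀ m : ℤ, Complex.exp (2 * Real.pi * Complex.I / n) ^ ((a : ℤ) * m) = q ^ m := by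
    intro m
    rw [zpow_mul, zpow_natCast, hqa]
  unfold nodalConfig
  simp only [he]
  -- The three special labels are exactly the zeros of the first form. There the common factor is
  -- the value of a form that does not vanish; for the other labels it is the value of the first
  -- form.
  split_ifs with e1 e2 e3
  · rw [hk1.mpr e1]
    refine (reps_mk _).normalize ((1 - q ^ 2) * (1 + q ^ 3) / (1 - q ^ 5) *
      ((1 - q) * (1 - q ^ 2 * q) * (1 - q / q ^ 2))) ?_ ?_ ?_ ?_
    · have l1 : 1 - q / q ^ 2 ≠ 0 := fun h => h1 (by field_simp at h; linear_combination -h)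
      have l2 : 1 - q ^ 2 * q ≠ 0 := fun h => h3 (by linear_combination h)
      simp [h1, h2, h5, k3, l1, l2]
    · simp [hq0]
    · simp
    · simp [hq0]
  · rw [hk2.mpr e2]
    refine (reps_mk _).normalize ((1 - q + q ^ 2) / (1 + q ^ 2) *
      ((1 - q ^ 2) * (1 - q * q ^ 2) * (1 - q ^ 2 / q))) ?_ ?_ ?_ ?_
    · have l1 : 1 - q ^ 2 / q ≠ 0 := fun h => h1 (by field_simp at h; linear_combination h)
      have l2 : 1 - q * q ^ 2 ≠ 0 := fun h => h3 (by linear_combination h)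
      simp [h2, k1, k2, l1, l2]
    · simp [hq0]
    · simp [hq0]
    · simp
  · have hw : q ^ k.val = 1 / q ^ 3 := by
      rw [eq_div_iff (pow_ne_zero 3 hq0)]
      exact hk3.mpr e3
    rw [hw]
    refine (reps_mk _).normalize ((1 - q + q ^ 2) / (1 + q ^ 2) *
      ((1 - 1 / q ^ 3) * (1 - q * (1 / q ^ 3)) * (1 - 1 / q ^ 3 / q))) ?_ ?_ ?_ ?_
    · have l1 : 1 - 1 / q ^ 3 ≠ 0 := fun h => h3 (by field_simp at h; linear_combination -h)
      have l2 : 1 - q * (1 / q ^ 3) ≠ 0 := fun h => h2 (by field_simp at h; linear_combination -h)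
      have l3 : 1 - 1 / q ^ 3 / q ≠ 0 := fun h => h4 (by field_simp at h; linear_combination -h)
      simp only [ne_eq, mul_eq_zero, div_eq_zero_iff, k1, k2, l1, l2, l3, or_self,
        not_false_eq_true]
    · simp [hq0]
    · simp
      field_simp
      ring
    · simp
  · set w := q ^ k.val with hw
    have w1 : w - q ≠ 0 := sub_ne_zero.mpr (mt hk1.mp e1)
    have w2 : w - q ^ 2 ≠ 0 := sub_ne_zero.mpr (mt hk2.mp e2)
    have w3 : 1 - q ^ 3 * w ≠ 0 := fun h => e3 (hk3.mp (by linear_combination -h))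
    have l1 : 1 - w / q ≠ 0 := fun h => w1 (by field_simp at h; linear_combination -h)
    have l2 : 1 - w / q ^ 2 ≠ 0 := fun h => w2 (by field_simp at h; linear_combination -h)
    have z0 : q ^ (k.val : ℤ) = w := zpow_natCast q _
    have z1 : q ^ ((k.val : ℤ) + 1) = q * w := by rw [zpow_add₀ hq0, z0, zpow_one, mul_comm]
    have z2 : q ^ ((k.val : ℤ) + 2) = q ^ 2 * w := by
      rw [zpow_add₀ hq0, z0, mul_comm]; norm_cast
    have z3 : q ^ ((k.val : ℤ) + 3) = q ^ 3 * w := by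
      rw [zpow_add₀ hq0, z0, mul_comm]; norm_cast
    have y1 : q ^ ((k.val : ℤ) - 1) = w / q := by rw [zpow_sub₀ hq0, z0, zpow_one]
    have y2 : q ^ ((k.val : ℤ) - 2) = w / q ^ 2 := by rw [zpow_sub₀ hq0, z0]; norm_cast
    have x1 : q ^ (1 : ℤ) = q := zpow_one q
    have x2 : q ^ (2 : ℤ) = q ^ 2 := by norm_cast
    have x3 : q ^ (3 : ℤ) = q ^ 3 := by norm_cast
    have x5 : q ^ (5 : ℤ) = q ^ 5 := by norm_cast
    refine (reps_mk _).normalize ((1 - w / q) * (1 - w / q ^ 2) * (1 - q ^ 3 * w))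
      (mul_ne_zero (mul_ne_zero l1 l2) w3) ?_ ?_ ?_
    · simp
    · simp only [z0, z2, z3, y1, x2, x3, x5, Matrix.cons_val]
      generalize (1 - w / q) = u at *
      generalize (1 - q ^ 3 * w) = u' at *
      field_simp
    · simp only [z0, z1, z3, y2, x1, x2, Matrix.cons_val]
      generalize (1 - w / q ^ 2) = u at *
      generalize (1 - q ^ 3 * w) = u' at *
      field_simp

theorem exists_nodalParam_nodalConfig {n : ℕ} (hn : 10 ≤ n) {a : ℕ} {q : ℂ}
    (hq : IsPrimitiveRoot q n) (hqa : Complex.exp (2 * Real.pi * Complex.I / n) ^ a = q) :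
    ∃ g : GL (Fin 3) ℂ, ∀ k, Reps ((Matrix.ProjGenLinGroup.mk g : PGL(3, ℂ)) • nodalConfig n a k)
      (nodalParam (q ^ k.val)) :=
  ⟨(Matrix.GeneralLinearGroup.mkOfDetNeZero _ (det_nodalMatrix_ne_zero hn hq))⁻¹,
    fun k => Reps.mk_inv_smul (reps_nodalConfig hn hq hqa k)⟩

/-- The nodal configurations are those equivalent to a cyclic subgroup of the standard nodal
cubic. -/
theorem arrangementClass_mem_nodalPoints_iff {n : ℕ} (hn : 10 ≤ n) (p : ZMod n → Plane) :
    arrangementClass p ∈ nodalPoints n ↔ ∃ (g : GL (Fin 3) ℂ) (q : ℂ), IsPrimitiveRoot q n ∧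
      ∀ k, Reps ((Matrix.ProjGenLinGroup.mk g : PGL(3, ℂ)) • p k) (nodalParam (q ^ k.val)) := by
  have hroot := Complex.isPrimitiveRoot_exp n (by omega)
  constructor
  · rintro ⟨a, -, hgcd, ha⟩
    obtain ⟨g, hg⟩ := exists_mk_smul_eq_of_arrangementClass_eq ha.symm
    have hq := hroot.pow_of_coprime a hgcd
    obtain ⟨g', hg'⟩ := exists_nodalParam_nodalConfig hn hq rfl
    refine ⟨g' * g, _, hq, fun k => ?_⟩
    rw [map_mul, mul_smul, hg]
    exact hg' k
  · rintro ⟨g, q, hq, hg⟩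
    have : NeZero n := ⟨by omega⟩
    -- Every primitive root is a power of exp(2πi/n) with exponent a < n coprime to n, so the list
    -- of explicit configurations is complete.
    obtain ⟨a, ha, rfl⟩ := hroot.eq_pow_of_pow_eq_one hq.pow_eq_one
    obtain ⟨g', hg'⟩ := exists_nodalParam_nodalConfig hn hq rfl
    refine ⟨a, ha, (hroot.pow_iff_coprime (by omega) a).mp hq, ?_⟩
    refine arrangementClass_eq_of_mk_smul_eq (g⁻¹ * g') fun k => ?_
    rw [map_mul, map_inv, mul_smul, inv_smul_eq_iff]
    exact (hg' k).eq (hg k)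

theorem isTorsionConfig_of_mem_nodalPoints {n : ℕ} (hn : 10 ≤ n) {p : ZMod n → Plane}
    (h : arrangementClass p ∈ nodalPoints n) : IsTorsionConfig p := by
  obtain ⟨g, q, hq, hg⟩ := (arrangementClass_mem_nodalPoints_iff hn p).mp h
  refine (isTorsionConfig_of_reps_nodalParam hn hq hg).mk_smul g⁻¹ fun k => ?_
  rw [map_inv, inv_smul_smul]

theorem isNodalCubic_of_mem_nodalPoints {n : ℕ} (hn : 10 ≤ n) {p : ZMod n → Plane}
    (h : arrangementClass p ∈ nodalPoints n) {F : MvPolynomial (Fin 3) ℂ}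
    (hF : IsUniqueCubicThrough F p) : IsNodalCubic F := by
  obtain ⟨g, q, hq, hg⟩ := (arrangementClass_mem_nodalPoints_iff hn p).mp h
  obtain ⟨c, hc, rfl⟩ := hF.exists_ne_zero_smul
    (subst_isHomogeneous g.val nodalForm_isHomogeneous) (subst_ne_zero g.isUnit nodalForm_ne_zero)
    ((vanishes_subst_iff (fun _ => rfl) nodalForm_isHomogeneous).mpr fun k =>
      ((hg k).eval_eq_zero_iff (reps_rep _) nodalForm_isHomogeneous).mp (eval_nodalParam _))
  exact isNodalCubic_smul hc (isNodalCubic_subst g.isUnit isNodalCubic_nodalForm)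

/-! ### The image of `phi` and the classification of torsion configurations -/

theorem arrangementClass_mem_range_phi_iff {n : ℕ} (p : ZMod n → Plane) :
    arrangementClass p ∈ Set.range (phi n) ↔ ∃ (g : GL (Fin 3) ℂ) (W : WeierstrassCurve ℂ)
      (P : W.toAffine.Point), W.Δ ≠ 0 ∧ addOrderOf P = n ∧
        ∀ k, (Matrix.ProjGenLinGroup.mk g : PGL(3, ℂ)) • p k = toPlane (k.val • P) := by
  constructor
  · rintro ⟨X, hX⟩
    induction X using Quotient.inductionOn with
    | _ X =>
      obtain ⟨g, hg⟩ := exists_mk_smul_eq_of_arrangementClass_eq (q := X.arrangement) hX.symm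
      exact ⟨g, X.curve, X.point, X.isElliptic.isUnit.ne_zero, X.order, hg⟩
  · rintro ⟨g, W, P, hW, hP, hg⟩
    let X : EllipticPair n := ⟨W, ⟨isUnit_iff_ne_zero.mpr hW⟩, P, hP⟩
    exact ⟨Quotient.mk _ X, (arrangementClass_eq_of_mk_smul_eq (q := X.arrangement) g hg).symm⟩

theorem vanishes_subst_weierstrass {n : ℕ} {p : ZMod n → Plane} {g : GL (Fin 3) ℂ}
    {W : WeierstrassCurve ℂ} {P : W.toAffine.Point}
    (h : ∀ k, (Matrix.ProjGenLinGroup.mk g : PGL(3, ℂ)) • p k = toPlane (k.val • P)) (k : ZMod n) :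
    eval (p k).rep (subst g.val W.toProjective.polynomial) = 0 :=
  (vanishes_subst_iff h (weierstrass_isHomogeneous W)).mpr (fun _ =>
    ((reps_toPlane _).eval_eq_zero_iff (reps_rep _) (weierstrass_isHomogeneous W)).mp
      (eval_coords _)) k

theorem isTorsionConfig_of_mem_range_phi {n : ℕ} (hn : 10 ≤ n) {p : ZMod n → Plane}
    (h : arrangementClass p ∈ Set.range (phi n)) : IsTorsionConfig p := by
  obtain ⟨g, W, P, -, hP, hg⟩ := (arrangementClass_mem_range_phi_iff p).mp h
  refine (isTorsionConfig_multiples hn P hP).mk_smul g⁻¹ fun k => ?_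
  rw [map_inv, inv_smul_eq_iff, hg]

theorem isSmoothCurve_of_mem_range_phi {n : ℕ} {p : ZMod n → Plane}
    (h : arrangementClass p ∈ Set.range (phi n)) {F : MvPolynomial (Fin 3) ℂ}
    (hF : IsUniqueCubicThrough F p) : IsSmoothCurve F := by
  obtain ⟨g, W, P, hW, hP, hg⟩ := (arrangementClass_mem_range_phi_iff p).mp h
  obtain ⟨c, hc, rfl⟩ := hF.exists_ne_zero_smul
    (subst_isHomogeneous g.val (weierstrass_isHomogeneous W))
    (subst_ne_zero g.isUnit (weierstrass_ne_zero W)) (vanishes_subst_weierstrass hg)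
  rw [isSmoothCurve_smul_iff hc]
  exact isSmoothCurve_subst g.isUnit (isSmoothCurve_weierstrass hW)

/-- The classification of torsion configurations, with the cubics that contain them. -/
theorem IsTorsionConfig.exists_cubic {n : ℕ} (hn : 10 ≤ n) {p : ZMod n → Plane}
    (hp : IsTorsionConfig p) :
    (arrangementClass p ∈ Set.range (phi n) ∨ arrangementClass p ∈ nodalPoints n) ∧
      ∃ F : MvPolynomial (Fin 3) ℂ, IsUniqueCubicThrough F p ∧ FormsCyclicSubgroup F p := by
  obtain ⟨g, W, P, hP, hg⟩ := hp.exists_weierstrass hn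
  refine ⟨?_, subst g.val W.toProjective.polynomial,
    hp.isUniqueCubicThrough hn (subst_isHomogeneous _ (weierstrass_isHomogeneous W))
      (subst_ne_zero g.isUnit (weierstrass_ne_zero W)) (vanishes_subst_weierstrass hg),
    g, W, P, ⟨1, one_ne_zero, fun v => by rw [eval_subst, one_mul]⟩, hP, hg⟩
  by_cases hW : W.Δ = 0
  · right
    rw [arrangementClass_mem_nodalPoints_iff hn]
    obtain ⟨g', q, hq, hg'⟩ := exists_nodalParam_of_Δ_eq_zero hn hW P hP
    refine ⟨g' * g, q, hq, fun k => ?_⟩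
    rw [map_mul, mul_smul, hg]
    exact hg' k
  · left
    rw [arrangementClass_mem_range_phi_iff]
    exact ⟨g, W, P, hW, hP, hg⟩

end TorsionArrangement

/-! ### The main theorem -/

theorem mainTheorem4 (n : ℕ) (hn : 10 ≤ n) :
    TorsionArrangement.realizationSpace
        (TorsionArrangement.torsionMatroid n (le_trans (by norm_num) hn)) =
      Set.range (TorsionArrangement.phi n) ∪ TorsionArrangement.nodalPoints n ∧
    ∀ p : ZMod n → TorsionArrangement.Plane,
      TorsionArrangement.IsRealization
        (TorsionArrangement.torsionMatroid n (le_trans (by norm_num) hn)) p →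
      ∃ F : MvPolynomial (Fin 3) ℂ,
        TorsionArrangement.IsUniqueCubicThrough F p ∧
        (TorsionArrangement.IsSmoothCurve F ∨ TorsionArrangement.IsNodalCubic F) ∧
        TorsionArrangement.FormsCyclicSubgroup F p ∧
        (TorsionArrangement.arrangementClass p ∈ Set.range (TorsionArrangement.phi n) ↔
          TorsionArrangement.IsSmoothCurve F) ∧
        (TorsionArrangement.arrangementClass p ∈ TorsionArrangement.nodalPoints n ↔
          TorsionArrangement.IsNodalCubic F) := by
  open TorsionArrangement in
  constructor
  · ext c
    constructor
    · rintro ⟨p, hp, rfl⟩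
      exact (((isRealization_iff hn _ p).mp hp).exists_cubic hn).1
    · intro hc
      obtain ⟨p, rfl⟩ : ∃ p, arrangementClass p = c := Quotient.exists_rep c
      refine ⟨p, (isRealization_iff hn _ p).mpr ?_, rfl⟩
      rcases hc with hc | hc
      · exact isTorsionConfig_of_mem_range_phi hn hc
      · exact isTorsionConfig_of_mem_nodalPoints hn hc
  · intro p hp
    obtain ⟨hor, F, hF, hcyc⟩ := ((isRealization_iff hn _ p).mp hp).exists_cubic hn
    have hs : arrangementClass p ∈ Set.range (phi n) → IsSmoothCurve F :=
      fun h => isSmoothCurve_of_mem_range_phi h hF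
    have hnod : arrangementClass p ∈ nodalPoints n → IsNodalCubic F :=
      fun h => isNodalCubic_of_mem_nodalPoints hn h hF
    -- Each class is of one of the two kinds, and a nodal cubic is not smooth, so the two
    -- implications `hs` and `hnod` are equivalences.
    refine ⟨F, hF, hor.imp hs hnod, hcyc, ⟨hs, fun h => ?_⟩, ⟨hnod, fun h => ?_⟩⟩
    · exact hor.resolve_right fun h' => (hnod h').not_isSmoothCurve h
    · exact hor.resolve_left fun h' => h.not_isSmoothCurve (hs h')
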